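/- All graphs are finite, simple, undirected and connected; $d$ is the graph distance and $I(x,y)=\{z : d(x,z)+d(z,y)=d(x,y)\}$. A graph $G=(V,E)$ is *median* if $I(x,y)\cap I(y,z)\cap I(z,x)$ is a singleton for all $x,y,z\in V$. Let $w:V\to\mathbb{R}_{\ge 0}$ be a weight function, $w(S)=\sum_{x\in S}w(x)$, $F_w(x)=\sum_{v\in V}w(v)\,d(x,v)$, and let $\mathrm{Med}_w(G)$ be the set of vertices minimizing $F_w$. The $\Theta$-classes of $G$ are the classes of edges under the reflexive transitive closure of the relation "opposite edges of a square (4-cycle)"; for an edge $uv$, the two halfspaces defined by its $\Theta$-class $E_i$ are the connected components $H_u\ni u$ and $H_v\ni v$ of $(V,E\setminus E_i)$. The majority rule directs $uv$ from $u$ to $v$ if $w(H_v)>w(H_u)$, from $v$ to $u$ if $w(H_u)>w(H_v)$, and leaves $uv$ undirected if $w(H_u)=w(H_v)$. A vertex is a sink if no edge is directed out of it. **Theorem.** (1) For every median graph $G$ and every weight function $w\ge 0$, $\mathrm{Med}_w(G)$ is exactly the set of sinks of the majority orientation of $G$. (2) There is an algorithm that, given a median graph $G$ with $m$ edges by its adjacency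 lists and a weight function $w\ge 0$ on its vertices, computes the median set $\mathrm{Med}_w(G)$ (as a list of its vertices), the weights of the two halfspaces defined by the $\Theta$-class of each edge, and the majority orientation of the edges, in $O(m)$ time, that is, in at most $C(m+1)$ steps for a constant $C$ independent of $G$ and $w$. Here time is the number of unit-cost operations of a random access machine whose words have $O(\log(n+m))$ bits, $n=|V|$, whose memory outside the input is not initialized, and which can copy, add, subtract and compare real numbers. -/

import Mathlib

/-! ## Median graphs, median sets, majority orientation -/

namespace MedianGraph

variable {V : Type*}

/-- The interval `I(u,v)`: all vertices on shortest paths between `u` and `v`. -/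
def interval (G : SimpleGraph V) (u v : V) : Set V :=
  {x | G.dist u x + G.dist x v = G.dist u v}

/-- Median graphs: connected, and the three intervals spanned by any triplet of vertices have
exactly one common vertex. -/
def IsMedian (G : SimpleGraph V) : Prop :=
  G.Connected ∧
    ∀ x y z : V, ∃! c : V, c ∈ interval G x y ∩ interval G y z ∩ interval G z x

/-- The weight `w(S)` of a set of vertices. -/
noncomputable def weight [Fintype V] (w : V → ℝ) (S : Set V) : ℝ :=
  ∑ x, S.indicator w x

/-- The median function `F_w(x) = ∑_v w(v) d(x,v)`. -/
noncomputable def medianFun [Fintype V] (G : SimpleGraph V) (w : V → ℝ) (x : V) : ℝ :=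
  ∑ v, w v * (G.dist x v : ℝ)

/-- The median set `Med_w(G)`: the minimizers of the median function. -/
def medianSet [Fintype V] (G : SimpleGraph V) (w : V → ℝ) : Set V :=
  {x | ∀ y, medianFun G w x ≤ medianFun G w y}

/-- `u v v' u'` is a square (a 4-cycle) of `G`. -/
def IsSquare (G : SimpleGraph V) (u v v' u' : V) : Prop :=
  G.Adj u v ∧ G.Adj v v' ∧ G.Adj v' u' ∧ G.Adj u' u ∧ u ≠ v' ∧ v ≠ u'

/-- The relation `Θ₀`: the two edges are opposite edges of a square. -/
def Theta0 (G : SimpleGraph V) (e e' : Sym2 V) : Prop :=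
  ∃ u v u' v' : V, e = s(u, v) ∧ e' = s(u', v') ∧ IsSquare G u v v' u'

/-- The `Θ`-class of the edge `e`, where `Θ` is the reflexive and transitive closure of the
(symmetric) relation `Θ₀` on the edges. -/
def thetaClass (G : SimpleGraph V) (e : Sym2 V) : Set (Sym2 V) :=
  {e' | e' ∈ G.edgeSet ∧ Relation.ReflTransGen (Theta0 G) e e'}

/-- For an edge `uv`: the halfspace containing the end `v`, among the two halfspaces defined by
the `Θ`-class of `uv`, i.e. the connected component of `v` after removing that class. -/
def halfspace (G : SimpleGraph V) (u v : V) : Set V :=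
  {x | (G.deleteEdges (thetaClass G s(u, v))).Reachable v x}

/-- The majority rule: the edge `uv` is directed from `u` to `v` when the halfspace containing
`v` is strictly heavier than the complementary halfspace, which contains `u`. -/
def Directed [Fintype V] (G : SimpleGraph V) (w : V → ℝ) (u v : V) : Prop :=
  G.Adj u v ∧ weight w (halfspace G v u) < weight w (halfspace G u v)

/-- The sinks of the majority orientation: no edge is directed out of them. -/
def sinks [Fintype V] (G : SimpleGraph V) (w : V → ℝ) : Set V :=
  {u | ∀ v, ¬ Directed G w u v}

end MedianGraph

/-! ## The machine model

Random access machine with unit-cost operations on words (natural numbers of `O(log N)` bits,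
where `N` is the input size) and on real numbers. Programs are finite texts that refer to
finitely many scalar variables and finitely many arrays, of words and of reals. Reals can only
be copied, added, subtracted and compared; there is no conversion between reals and words. -/

namespace RealRAM

/-- A memory state: word variables, word arrays, real variables and real arrays, each named by
a number. -/
structure State where
  var : ℕ → ℕ
  arr : ℕ → ℕ → ℕ
  rvar : ℕ → ℝ
  rarr : ℕ → ℕ → ℝ

/-- Word expressions: literals, variables, array access, and arithmetic. -/
inductive Exp : Type
  | lit (c : ℕ)
  | var (x : ℕ)
  | get (a : ℕ) (i : Exp)
  | add (e f : Exp)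
  | sub (e f : Exp)
  | mul (e f : Exp)

namespace Exp

/-- The value of a word expression (subtraction is truncated at `0`). -/
def eval (s : State) : Exp → ℕ
  | lit c => c
  | var x => s.var x
  | get a i => s.arr a (i.eval s)
  | add e f => e.eval s + f.eval s
  | sub e f => e.eval s - f.eval s
  | mul e f => e.eval s * f.eval s

/-- The number of unit-cost operations in the evaluation: one for each node. -/
def cost : Exp → ℕ
  | lit _ => 1
  | var _ => 1
  | get _ i => i.cost + 1
  | add e f => e.cost + f.cost + 1
  | sub e f => e.cost + f.cost + 1
  | mul e f => e.cost + f.cost + 1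

/-- No overflow: all values met in the evaluation are at most `B`. -/
def Fits (B : ℕ) (s : State) : Exp → Prop
  | lit c => c ≤ B
  | var x => s.var x ≤ B
  | get a i => i.Fits B s ∧ s.arr a (i.eval s) ≤ B
  | add e f => e.Fits B s ∧ f.Fits B s ∧ e.eval s + f.eval s ≤ B
  | sub e f => e.Fits B s ∧ f.Fits B s
  | mul e f => e.Fits B s ∧ f.Fits B s ∧ e.eval s * f.eval s ≤ B

end Exp

/-- Real expressions: variables, array access, addition and subtraction. -/
inductive RExp : Type
  | var (x : ℕ)
  | get (a : ℕ) (i : Exp)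
  | add (e f : RExp)
  | sub (e f : RExp)

namespace RExp

/-- The value of a real expression. -/
noncomputable def eval (s : State) : RExp → ℝ
  | var x => s.rvar x
  | get a i => s.rarr a (i.eval s)
  | add e f => e.eval s + f.eval s
  | sub e f => e.eval s - f.eval s

/-- The number of unit-cost operations in the evaluation. -/
def cost : RExp → ℕ
  | var _ => 1
  | get _ i => i.cost + 1
  | add e f => e.cost + f.cost + 1
  | sub e f => e.cost + f.cost + 1

/-- No overflow in the evaluation of the array indices. -/
def Fits (B : ℕ) (s : State) : RExp → Prop
  | var _ => True
  | get _ i => i.Fits B s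
  | add e f => e.Fits B s ∧ f.Fits B s
  | sub e f => e.Fits B s ∧ f.Fits B s

end RExp

/-- Tests: strict comparison of words or of reals, negation, conjunction. -/
inductive Test : Type
  | lt (e f : Exp)
  | rlt (e f : RExp)
  | not (b : Test)
  | and (b c : Test)

namespace Test

/-- The truth of a test. -/
def eval (s : State) : Test → Prop
  | lt e f => e.eval s < f.eval s
  | rlt e f => e.eval s < f.eval s
  | not b => ¬ b.eval s
  | and b c => b.eval s ∧ c.eval s

/-- The number of unit-cost operations charged for a test. -/
def cost : Test → ℕ
  | lt e f => e.cost + f.cost + 1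
  | rlt e f => e.cost + f.cost + 1
  | not b => b.cost + 1
  | and b c => b.cost + c.cost + 1

/-- No overflow; the second conjunct is only evaluated when the first one holds. -/
def Fits (B : ℕ) (s : State) : Test → Prop
  | lt e f => e.Fits B s ∧ f.Fits B s
  | rlt e f => e.Fits B s ∧ f.Fits B s
  | not b => b.Fits B s
  | and b c => b.Fits B s ∧ (b.eval s → c.Fits B s)

end Test

/-- Programs. -/
inductive Prog : Type
  | skip
  | assign (x : ℕ) (e : Exp)
  | store (a : ℕ) (i e : Exp)
  | rassign (x : ℕ) (e : RExp)
  | rstore (a : ℕ) (i : Exp) (e : RExp)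
  | seq (p q : Prog)
  | ite (b : Test) (p q : Prog)
  | loop (b : Test) (p : Prog)

/-- `Exec B p s t s'`: started in the state `s`, the program `p` halts in the state `s'` after
exactly `t` unit-cost operations, and all words computed on the way are at most `B`. The relation
is deterministic; a computation that overflows the bound `B` has no outcome.
`loop b p` is the loop "while `b` do `p`". -/
inductive Exec (B : ℕ) : Prog → State → ℕ → State → Prop
  | skip (s : State) : Exec B .skip s 1 s
  | assign (x : ℕ) (e : Exp) (s : State) (he : e.Fits B s) :
      Exec B (.assign x e) s (e.cost + 1)
        { s with var := Function.update s.var x (e.eval s) }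
  | store (a : ℕ) (i e : Exp) (s : State) (hi : i.Fits B s) (he : e.Fits B s) :
      Exec B (.store a i e) s (i.cost + e.cost + 1)
        { s with arr := Function.update s.arr a
                          (Function.update (s.arr a) (i.eval s) (e.eval s)) }
  | rassign (x : ℕ) (e : RExp) (s : State) (he : e.Fits B s) :
      Exec B (.rassign x e) s (e.cost + 1)
        { s with rvar := Function.update s.rvar x (e.eval s) }
  | rstore (a : ℕ) (i : Exp) (e : RExp) (s : State) (hi : i.Fits B s) (he : e.Fits B s) :
      Exec B (.rstore a i e) s (i.cost + e.cost + 1)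
        { s with rarr := Function.update s.rarr a
                          (Function.update (s.rarr a) (i.eval s) (e.eval s)) }
  | seq (p q : Prog) (s s' s'' : State) (t t' : ℕ)
      (hp : Exec B p s t s') (hq : Exec B q s' t' s'') :
      Exec B (.seq p q) s (t + t') s''
  | ite_true (b : Test) (p q : Prog) (s s' : State) (t : ℕ) (hf : b.Fits B s)
      (hb : b.eval s) (hp : Exec B p s t s') :
      Exec B (.ite b p q) s (b.cost + t) s'
  | ite_false (b : Test) (p q : Prog) (s s' : State) (t : ℕ) (hf : b.Fits B s)
      (hb : ¬ b.eval s) (hq : Exec B q s t s') :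
      Exec B (.ite b p q) s (b.cost + t) s'
  | loop_done (b : Test) (p : Prog) (s : State) (hf : b.Fits B s) (hb : ¬ b.eval s) :
      Exec B (.loop b p) s b.cost s
  | loop_step (b : Test) (p : Prog) (s s' s'' : State) (t t' : ℕ) (hf : b.Fits B s)
      (hb : b.eval s) (hp : Exec B p s t s') (hl : Exec B (.loop b p) s' t' s'') :
      Exec B (.loop b p) s (b.cost + t + t') s''

end RealRAM

/-! ## Input and output conventions -/

namespace MedianGraph

open RealRAM

/-- The state `s` holds the graph `G` with vertices `0, …, n-1`, given by adjacency lists in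
arbitrary order, and the weight function `w`. Word variable `0` contains `n`. The adjacency list
of `v` occupies in word array `1` the positions `p` with `start v ≤ p < start (v+1)`, where
`start` is word array `0` and `start 0 = 0`. Real array `0` contains the weights.
The rest of the memory is not initialized: its content is arbitrary. -/
structure IsInput {n : ℕ} (G : SimpleGraph (Fin n)) (w : Fin n → ℝ) (s : State) : Prop where
  size : s.var 0 = n
  start_zero : s.arr 0 0 = 0
  start_le : ∀ v : Fin n, s.arr 0 v ≤ s.arr 0 ((v : ℕ) + 1)
  neighbors : ∀ v : Fin n,
    Set.BijOn (s.arr 1) (Set.Ico (s.arr 0 v) (s.arr 0 ((v : ℕ) + 1))) (Fin.val '' G.neighborSet v)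
  weights : ∀ v : Fin n, s.rarr 0 v = w v

/-- The final state `s'` lists the set `M` of vertices: its number of elements is in word
variable `1` and its elements, each of them once, are the first entries of word array `2`. -/
def ListsSet {n : ℕ} (M : Set (Fin n)) (s' : State) : Prop :=
  Set.BijOn (s'.arr 2) (Set.Iio (s'.var 1)) (Fin.val '' M)

/-- The final state `s'` contains the weights of all halfspaces: if `p` is the position of the
neighbor `u` in the adjacency list of `v` in the input `s`, then entry `p` of real array `1` is
the weight of the halfspace containing `u` that is defined by the `Θ`-class of `vu`. -/
def HasHalfspaceWeights {n : ℕ} (G : SimpleGraph (Fin n)) (w : Fin n → ℝ)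
    (s s' : State) : Prop :=
  ∀ v u : Fin n, ∀ p ∈ Set.Ico (s.arr 0 v) (s.arr 0 ((v : ℕ) + 1)), s.arr 1 p = u →
    s'.rarr 1 p = weight w (halfspace G v u)

/-- The final state `s'` contains the majority orientation: if `p` is the position of the
neighbor `u` in the adjacency list of `v` in the input `s`, then entry `p` of word array `3` is
`1` if the edge `vu` is directed from `v` to `u`, and `0` if not. -/
def HasOrientation {n : ℕ} (G : SimpleGraph (Fin n)) (w : Fin n → ℝ)
    (s s' : State) : Prop :=
  ∀ v u : Fin n, ∀ p ∈ Set.Ico (s.arr 0 v) (s.arr 0 ((v : ℕ) + 1)), s.arr 1 p = u →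
    (Directed G w v u → s'.arr 3 p = 1) ∧ (¬ Directed G w v u → s'.arr 3 p = 0)

end MedianGraph

/-! Sinks. For an edge uv, the halfspace of v is the set `side G u v` of vertices closer to v than
to u: opposite edges of a square have equal sides, and every edge between the two sides is joined to
uv by a ladder of squares (`crossing_edge`, `halfspace_eq_side`). Moving from u to v changes each
distance by one, so F(u) - F(v) = w(H_v) - w(H_u), and a median vertex is a sink. Conversely, let u
be a sink and H a halfspace avoiding u. Halfspaces are convex and gated; if v is the neighbor of u
towards its gate in H, then H lies in the side of v, which has at most half of the total weight. As
w is nonnegative, H has at most half as well, so no step of a geodesic towards u increases F.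

Algorithm. Fix a root r and a breadth-first numbering. A halfspace avoiding r is named by the number
of the gate of r in it, its label; labels are injective and increase when the halfspace shrinks. Let
M(x) be the largest label of a halfspace left by an edge from x towards r, and let the father of x
be the neighbor across that halfspace. The father has a value of M below M(x), every other
down-neighbor has exactly the value M(x), and if there is only one down-neighbor then M(x) is the
number of x. So the minimum and maximum of M over the down-neighbors give the father and M(x)
(`scan_spec`), and no `Θ`-class is ever built.

In the tree of fathers, a path to r never enters a halfspace H avoiding r, and it leaves H at x
exactly when M(x) is the label of H. Hence moving the weights to the root in reverse order, and
adding what leaves x to the counter M(x), produces the weights of all these halfspaces. An edge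
outside the tree is opposite, in a square, to the edge between the fathers of its ends
(`father_square`), so its halfspace weight is copied from the row of a father, filled earlier. Every
row is scanned a bounded number of times, and n ≤ m + 1 by connectedness. -/

namespace MedianGraph

/-! ### Distances, squares and halfspaces in median graphs -/

variable {V : Type*} {G : SimpleGraph V}

/-- The set of vertices closer to `v` than to `u`. -/
def side (G : SimpleGraph V) (u v : V) : Set V :=
  {x | G.dist x v < G.dist x u}

theorem mem_side {u v x : V} : x ∈ side G u v ↔ G.dist x v < G.dist x u := Iff.rfl

theorem mem_side_right {u v : V} (h : G.Adj u v) : v ∈ side G u v := by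
  simp [mem_side, SimpleGraph.dist_eq_one_iff_adj.2 h.symm]

theorem left_notMem_side {u v : V} : u ∉ side G u v := by
  simp [mem_side]

namespace IsMedian

variable (hG : IsMedian G)

include hG

theorem exists_median (x y z : V) : ∃ c, G.dist x c + G.dist c y = G.dist x y ∧
    G.dist y c + G.dist c z = G.dist y z ∧ G.dist z c + G.dist c x = G.dist z x := by
  obtain ⟨c, ⟨⟨h1, h2⟩, h3⟩, -⟩ := hG.2 x y z
  exact ⟨c, h1, h2, h3⟩

theorem median_unique {x y z c c' : V} (h1 : G.dist x c + G.dist c y = G.dist x y)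
    (h2 : G.dist y c + G.dist c z = G.dist y z) (h3 : G.dist z c + G.dist c x = G.dist z x)
    (h1' : G.dist x c' + G.dist c' y = G.dist x y)
    (h2' : G.dist y c' + G.dist c' z = G.dist y z)
    (h3' : G.dist z c' + G.dist c' x = G.dist z x) : c = c' :=
  (hG.2 x y z).unique ⟨⟨h1, h2⟩, h3⟩ ⟨⟨h1', h2'⟩, h3'⟩

theorem dist_triangle (x y z : V) : G.dist x z ≤ G.dist x y + G.dist y z :=
  hG.1.dist_triangle

/-- This is bipartiteness: the median of x, u, v lies in the interval of the edge uv, so it is u or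
v, and then the two distances to x differ by one. -/
theorem dist_ne_of_adj {u v : V} (h : G.Adj u v) (x : V) : G.dist x u ≠ G.dist x v := by
  intro he
  obtain ⟨c, h1, h2, h3⟩ := hG.exists_median x u v
  have huv := SimpleGraph.dist_eq_one_iff_adj.2 h
  have e1 := G.dist_comm (u := v) (v := c)
  have e2 := G.dist_comm (u := u) (v := c)
  have e3 := G.dist_comm (u := x) (v := c)
  have e4 := G.dist_comm (u := x) (v := v)
  omega

theorem dist_adj {u v : V} (h : G.Adj u v) (x : V) :
    G.dist x u = G.dist x v + 1 ∨ G.dist x v = G.dist x u + 1 := by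
  have h1 := hG.dist_ne_of_adj h x
  have h2 := hG.dist_triangle x u v
  have h3 := hG.dist_triangle x v u
  have h4 := SimpleGraph.dist_eq_one_iff_adj.2 h
  have h5 := SimpleGraph.dist_eq_one_iff_adj.2 h.symm
  omega

theorem side_compl {u v : V} (h : G.Adj u v) : (side G u v)ᶜ = side G v u := by
  ext x
  have := hG.dist_adj h x
  simp only [Set.mem_compl_iff, mem_side]
  omega

theorem mem_side_iff {u v x : V} (h : G.Adj u v) :
    x ∈ side G u v ↔ G.dist x u = G.dist x v + 1 := by
  have := hG.dist_adj h x
  rw [mem_side]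
  omega

theorem notMem_side_iff {u v x : V} (h : G.Adj u v) :
    x ∉ side G u v ↔ G.dist x v = G.dist x u + 1 := by
  have := hG.dist_adj h x
  rw [mem_side]
  omega

theorem exists_adj_closer {x z : V} (h : x ≠ z) :
    ∃ y, G.Adj x y ∧ G.dist x z = G.dist y z + 1 := by
  obtain ⟨p, hp⟩ := hG.1.exists_walk_length_eq_dist x z
  cases p with
  | nil => exact absurd rfl h
  | @cons _ y _ hxy q =>
    refine ⟨y, hxy, ?_⟩
    have h1 := SimpleGraph.dist_le q
    have h2 := hG.dist_triangle x y z
    have h3 := SimpleGraph.dist_eq_one_iff_adj.2 hxy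
    rw [SimpleGraph.Walk.length_cons] at hp
    omega

/-- The median of r, y, z is the required vertex. It is equidistant from y and z, so d(y,z) is even;
as y and z are distinct with common neighbor x, this distance is 2. -/
theorem quadrangle {r x y z : V} (hy : G.Adj x y) (hz : G.Adj x z) (hyz : y ≠ z)
    (dy : G.dist r x = G.dist r y + 1) (dz : G.dist r x = G.dist r z + 1) :
    ∃ c, G.Adj y c ∧ G.Adj z c ∧ G.dist r y = G.dist r c + 1 := by
  obtain ⟨c, h1, h2, h3⟩ := hG.exists_median r y z
  have e1 := G.dist_comm (u := z) (v := c)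
  have e2 := G.dist_comm (u := y) (v := c)
  have e3 := G.dist_comm (u := r) (v := c)
  have e4 := G.dist_comm (u := r) (v := z)
  have e5 := G.dist_comm (u := y) (v := x)
  have h4 := hG.dist_triangle y x z
  have h5 := SimpleGraph.dist_eq_one_iff_adj.2 hy
  have h6 := SimpleGraph.dist_eq_one_iff_adj.2 hz
  have h7 := hG.1.pos_dist_of_ne hyz
  refine ⟨c, SimpleGraph.dist_eq_one_iff_adj.1 ?_, SimpleGraph.dist_eq_one_iff_adj.1 ?_, ?_⟩ <;>
    omega

/-- If x were closer to v than to u but closer to u' than to v', then v and u' would both be medians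
of x, u, v'. -/
theorem side_subset_of_square {u v v' u' : V} (h : IsSquare G u v v' u') :
    side G u v ⊆ side G u' v' := by
  obtain ⟨huv, hvv, hvu, huu, hne, hne'⟩ := h
  intro x hx
  by_contra hx'
  rw [hG.mem_side_iff huv] at hx
  rw [hG.notMem_side_iff hvu.symm] at hx'
  have h1 := hG.dist_adj hvv x
  have h2 := hG.dist_adj huu x
  have a1 := SimpleGraph.dist_eq_one_iff_adj.2 huv
  have a2 := SimpleGraph.dist_eq_one_iff_adj.2 hvv
  have a3 := SimpleGraph.dist_eq_one_iff_adj.2 hvu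
  have a4 := SimpleGraph.dist_eq_one_iff_adj.2 huu
  have b1 := SimpleGraph.dist_eq_one_iff_adj.2 huv.symm
  have b2 := SimpleGraph.dist_eq_one_iff_adj.2 hvv.symm
  have b3 := SimpleGraph.dist_eq_one_iff_adj.2 hvu.symm
  have b4 := SimpleGraph.dist_eq_one_iff_adj.2 huu.symm
  have c1 := hG.dist_triangle u v v'
  have c2 := hG.1.pos_dist_of_ne hne
  have c3 : G.dist u v' ≠ 1 := by
    have := hG.dist_ne_of_adj hvv u
    omega
  have c4 := G.dist_comm (u := u) (v := v')
  have c5 := G.dist_comm (u := u) (v := x)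
  have c6 := G.dist_comm (u := v') (v := x)
  have c7 := G.dist_comm (u := u') (v := x)
  have c8 := G.dist_comm (u := v) (v := x)
  exact hne' (hG.median_unique (x := x) (y := u) (z := v') (c := v) (c' := u')
    (by omega) (by omega) (by omega) (by omega) (by omega) (by omega))

theorem side_eq_of_square {u v v' u' : V} (h : IsSquare G u v v' u') :
    side G u v = side G u' v' := by
  refine (hG.side_subset_of_square h).antisymm (hG.side_subset_of_square ?_)
  obtain ⟨huv, hvv, hvu, huu, hne, hne'⟩ := h
  exact ⟨hvu.symm, hvv.symm, huv.symm, huu.symm, hne'.symm, hne.symm⟩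

/-- An edge that leaves a side of `uv` is connected to `uv` by a ladder of squares. -/
theorem crossing_edge {u v : V} (huv : G.Adj u v) {a b : V} (hab : G.Adj a b)
    (ha : a ∉ side G u v) (hb : b ∈ side G u v) :
    Relation.ReflTransGen (Theta0 G) s(u, v) s(a, b) ∧ side G u v = side G a b := by
  induction hk : G.dist a u generalizing a b with
  | zero =>
    rw [hG.1.dist_eq_zero_iff] at hk
    subst hk
    rw [hG.mem_side_iff huv, SimpleGraph.dist_comm, SimpleGraph.dist_eq_one_iff_adj.2 hab] at hb
    have : b = v := by rw [← hG.1.dist_eq_zero_iff]; omega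
    subst this
    exact ⟨.refl, rfl⟩
  | succ k ih =>
    rw [hG.notMem_side_iff huv] at ha
    rw [hG.mem_side_iff huv] at hb
    have hau : a ≠ u := by rintro rfl; simp at hk
    obtain ⟨a', haa, hd⟩ := hG.exists_adj_closer hau
    have h1 := hG.dist_adj haa v
    have h2 := hG.dist_triangle a' u v
    have h3 := SimpleGraph.dist_eq_one_iff_adj.2 huv
    have h4 := hG.dist_adj hab v
    have h5 := hG.dist_adj hab u
    have e1 := G.dist_comm (u := v) (v := a)
    have e2 := G.dist_comm (u := v) (v := a')
    have e3 := G.dist_comm (u := v) (v := b)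
    have e4 := G.dist_comm (u := u) (v := a)
    have e5 := G.dist_comm (u := u) (v := b)
    have hne : a' ≠ b := by rintro rfl; omega
    -- Both a' (one step from a towards u) and b are closer to v than a is. The square a' b' b a
    -- they span is the next rung of the ladder, and a'b' is a crossing edge nearer to u.
    obtain ⟨b', hb1, hb2, hb3⟩ := hG.quadrangle (r := v) haa hab hne (by omega) (by omega)
    have e6 := G.dist_comm (u := v) (v := b')
    have e7 := G.dist_comm (u := u) (v := b')
    have e8 := G.dist_comm (u := u) (v := a')
    have h6 := hG.dist_adj hb1 u
    have h7 := hG.dist_adj hb2 u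
    have hne2 : a ≠ b' := by rintro rfl; omega
    have hsq : IsSquare G a' b' b a := ⟨hb1, hb2.symm, hab.symm, haa, hne, hne2.symm⟩
    obtain ⟨i1, i2⟩ := ih hb1 (by rw [hG.notMem_side_iff huv]; omega)
      (by rw [hG.mem_side_iff huv]; omega) (by omega)
    exact ⟨i1.tail ⟨a', b', a, b, rfl, rfl, hsq⟩, i2.trans (hG.side_eq_of_square hsq)⟩

theorem side_eq_of_crossing {u v a b : V} (huv : G.Adj u v) (hab : G.Adj a b)
    (ha : a ∉ side G u v) (hb : b ∈ side G u v) : side G u v = side G a b :=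
  (hG.crossing_edge huv hab ha hb).2

theorem side_eq_of_theta {u v : V} {e : Sym2 V} (huv : G.Adj u v)
    (h : Relation.ReflTransGen (Theta0 G) s(u, v) e) :
    ∃ a b, e = s(a, b) ∧ G.Adj a b ∧ side G u v = side G a b := by
  induction h with
  | refl => exact ⟨u, v, rfl, huv, rfl⟩
  | tail _ h2 ih =>
    obtain ⟨a, b, rfl, hab, hs⟩ := ih
    obtain ⟨a', b', c, d, h3, rfl, hsq⟩ := h2
    have hs' := hG.side_eq_of_square hsq
    rw [Sym2.eq_iff] at h3
    rcases h3 with ⟨rfl, rfl⟩ | ⟨rfl, rfl⟩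
    · exact ⟨c, d, rfl, hsq.2.2.1.symm, hs.trans hs'⟩
    · refine ⟨d, c, Sym2.eq_swap, hsq.2.2.1, ?_⟩
      rw [hs, ← hG.side_compl hab.symm, ← hG.side_compl hsq.2.2.1.symm, hs']

/-- A walk can leave the side only along a crossing edge, which belongs to the deleted class.
Conversely a geodesic to v stays in the side, and no edge inside the side is deleted, because an
edge of the class separates the two sides. -/
theorem halfspace_eq_side {u v : V} (huv : G.Adj u v) : halfspace G u v = side G u v := by
  ext x
  constructor
  · rintro ⟨p⟩
    have key : ∀ {a b : V}, (G.deleteEdges (thetaClass G s(u, v))).Walk a b →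
        a ∈ side G u v → b ∈ side G u v := by
      intro a b p
      induction p with
      | nil => exact id
      | @cons a c b hac q ih =>
        intro ha
        rw [SimpleGraph.deleteEdges_adj] at hac
        refine ih (by_contra fun hc => hac.2 ⟨hac.1, ?_⟩)
        rw [Sym2.eq_swap (a := a)]
        exact (hG.crossing_edge huv hac.1.symm hc ha).1
    exact key p (mem_side_right huv)
  · intro hx
    induction hk : G.dist x v generalizing x with
    | zero =>
      rw [hG.1.dist_eq_zero_iff] at hk
      subst hk
      exact SimpleGraph.Reachable.refl _
    | succ k ih =>
      have hxv : x ≠ v := by rintro rfl; simp at hk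
      obtain ⟨y, hxy, hd⟩ := hG.exists_adj_closer hxv
      rw [hG.mem_side_iff huv] at hx
      have h1 := hG.dist_adj hxy u
      have h2 := hG.dist_triangle y v u
      have h3 := SimpleGraph.dist_eq_one_iff_adj.2 huv.symm
      have e1 := G.dist_comm (u := u) (v := x)
      have e2 := G.dist_comm (u := u) (v := y)
      have hy : y ∈ side G u v := by rw [hG.mem_side_iff huv]; omega
      have hx : x ∈ side G u v := by rw [hG.mem_side_iff huv]; omega
      refine (ih y hy (by omega)).trans (SimpleGraph.Adj.reachable ?_)
      rw [SimpleGraph.deleteEdges_adj]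
      refine ⟨hxy.symm, fun hc => ?_⟩
      obtain ⟨a, b, he, hab, hs⟩ := hG.side_eq_of_theta huv hc.2
      rw [Sym2.eq_iff] at he
      rcases he with ⟨rfl, rfl⟩ | ⟨rfl, rfl⟩
      · exact left_notMem_side (hs ▸ hy)
      · exact left_notMem_side (hs ▸ hx)

/-- If a geodesic from x to y left the side along an edge xx', this edge would define the same side,
so y would be closer to x than to x'. -/
theorem side_convex {u v x y z : V} (huv : G.Adj u v) (hx : x ∈ side G u v)
    (hy : y ∈ side G u v) (hz : G.dist x z + G.dist z y = G.dist x y) : z ∈ side G u v := by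
  induction hk : G.dist x z generalizing x with
  | zero =>
    rw [hG.1.dist_eq_zero_iff] at hk
    exact hk ▸ hx
  | succ k ih =>
    have hxz : x ≠ z := by rintro rfl; simp at hk
    obtain ⟨x', hxx, hd⟩ := hG.exists_adj_closer hxz
    have h1 := hG.dist_triangle x' z y
    have h2 := hG.dist_triangle x x' y
    have h3 := SimpleGraph.dist_eq_one_iff_adj.2 hxx
    refine ih (x := x') (by_contra fun hx' => ?_) (by omega) (by omega)
    rw [hG.side_eq_of_crossing huv hxx.symm hx' hx, mem_side] at hy
    have e1 := G.dist_comm (u := y) (v := x)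
    have e2 := G.dist_comm (u := y) (v := x')
    omega

/-- Every vertex has a gate in every halfspace. -/
theorem exists_gate {u v : V} (huv : G.Adj u v) (r : V) : ∃ g ∈ side G u v,
    ∀ z ∈ side G u v, G.dist r g + G.dist g z = G.dist r z := by
  have hne : (side G u v).Nonempty := ⟨v, mem_side_right huv⟩
  let g := Function.argminOn (G.dist r) (side G u v) hne
  have hg : g ∈ side G u v := Function.argminOn_mem _ _ hne
  refine ⟨g, hg, fun z hz => ?_⟩
  -- For g nearest to r, convexity puts the median of r, g, z in the side, and minimality then
  -- forces it to be g.
  obtain ⟨c, h1, h2, h3⟩ := hG.exists_median r g z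
  have hc := hG.side_convex huv hg hz h2
  have h4 : G.dist r g ≤ G.dist r c := Function.argminOn_le (G.dist r) _ hc
  have h5 : c = g := by
    rw [← hG.1.dist_eq_zero_iff]
    omega
  rw [h5] at h3
  rw [G.dist_comm (u := r), G.dist_comm (u := g) (v := z), G.dist_comm (u := r) (v := z)]
  omega

/-! ### Majority orientation and the median function -/

section weights

variable [Fintype V] (w : V → ℝ)

theorem weight_side_add {u v : V} (huv : G.Adj u v) :
    weight w (side G v u) + weight w (side G u v) = ∑ x, w x := by
  rw [← hG.side_compl huv, weight, weight, ← Finset.sum_add_distrib]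
  exact Finset.sum_congr rfl fun x _ => Set.indicator_compl_add_self_apply _ _ _

/-- Each vertex contributes its weight with a plus sign if it is closer to v and with a minus sign
if it is closer to u. -/
theorem medianFun_sub {u v : V} (huv : G.Adj u v) :
    medianFun G w u - medianFun G w v = weight w (side G u v) - weight w (side G v u) := by
  rw [← hG.side_compl huv]
  simp only [medianFun, weight, ← Finset.sum_sub_distrib]
  refine Finset.sum_congr rfl fun x _ => ?_
  rw [G.dist_comm (u := u), G.dist_comm (u := v)]
  by_cases hx : x ∈ side G u v
  · rw [Set.indicator_of_mem hx, Set.indicator_of_notMem (by simpa using hx),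
      (hG.mem_side_iff huv).1 hx]
    push_cast
    ring
  · rw [Set.indicator_of_notMem hx, Set.indicator_of_mem (by simpa using hx),
      (hG.notMem_side_iff huv).1 hx]
    push_cast
    ring

theorem directed_iff {u v : V} : Directed G w u v ↔
    G.Adj u v ∧ weight w (side G v u) < weight w (side G u v) := by
  refine and_congr_right fun h => ?_
  rw [hG.halfspace_eq_side h, hG.halfspace_eq_side h.symm]

variable {w}

omit hG in
theorem weight_mono (hw : ∀ v, 0 ≤ w v) {S T : Set V} (h : S ⊆ T) : weight w S ≤ weight w T :=
  Finset.sum_le_sum fun x _ => Set.indicator_le_indicator_of_subset h hw x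

/-- Induction along a geodesic from y to u: the step from y to x does not increase F once the
halfspace of y, which avoids u, is known to carry at most half of the total weight. -/
theorem medianFun_le_of_mem_sinks (hw : ∀ v, 0 ≤ w v) {u : V} (hu : u ∈ sinks G w) (y : V) :
    medianFun G w u ≤ medianFun G w y := by
  induction hk : G.dist y u generalizing y with
  | zero =>
    rw [hG.1.dist_eq_zero_iff] at hk
    rw [hk]
  | succ k ih =>
    have hyu : y ≠ u := by rintro rfl; simp at hk
    obtain ⟨x, hyx, hd⟩ := hG.exists_adj_closer hyu
    refine (ih x (by omega)).trans ?_
    have hsub := hG.medianFun_sub w hyx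
    suffices h : weight w (side G x y) ≤ weight w (side G y x) by linarith
    obtain ⟨g, hg, hgate⟩ := hG.exists_gate hyx.symm u
    have hu' : u ∉ side G x y := by
      rw [mem_side, G.dist_comm (u := u), G.dist_comm (u := u)]
      omega
    obtain ⟨v, huv, hv⟩ := hG.exists_adj_closer (x := u) (z := g) (by rintro rfl; exact hu' hg)
    -- The gate g lies on a geodesic from u to every z of the halfspace, and v is one step closer to
    -- g, hence to z.
    have hle : side G x y ⊆ side G u v := by
      intro z hz
      have h1 := hgate z hz
      have h2 := hG.dist_triangle v g z
      rw [mem_side, G.dist_comm (u := z), G.dist_comm (u := z)]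
      omega
    have h1 := weight_mono hw hle
    have h2 : ¬ Directed G w u v := hu v
    rw [hG.directed_iff, not_and, not_lt] at h2
    have h3 := h2 huv
    have h4 := hG.weight_side_add w huv
    have h5 := hG.weight_side_add w hyx
    linarith

theorem medianSet_eq_sinks (hw : ∀ v, 0 ≤ w v) : medianSet G w = sinks G w := by
  ext u
  refine ⟨fun hu v hd => ?_, fun hu y => hG.medianFun_le_of_mem_sinks hw hu y⟩
  rw [hG.directed_iff] at hd
  have h1 := hG.medianFun_sub w hd.1
  have h2 := hu v
  linarith [hd.2]

end weights

end IsMedian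

/-! ### Labels of halfspaces and the tree of fathers -/

/-- `y` is a neighbor of `x` that is closer to `r`. -/
def Down (G : SimpleGraph V) (r x y : V) : Prop :=
  G.Adj x y ∧ G.dist r x = G.dist r y + 1

/-- `H` is a halfspace that does not contain `r`. -/
def AwayHalfspace (G : SimpleGraph V) (r : V) (H : Set V) : Prop :=
  r ∉ H ∧ ∃ u v, G.Adj u v ∧ H = side G u v

/-- `idx` numbers the vertices by nondecreasing distance from `r`. -/
structure IsBFSNumbering (G : SimpleGraph V) (r : V) (idx : V → ℕ) : Prop where
  injective : Function.Injective idx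
  lt_of_dist_lt : ∀ u v, G.dist r u < G.dist r v → idx u < idx v
  root : idx r = 0

/-- The smallest number of a vertex of `H`. -/
noncomputable def label (idx : V → ℕ) (H : Set V) : ℕ := sInf (idx '' H)

/-- The largest label of a halfspace that is left along an edge from `x` towards `r`. -/
noncomputable def maxLabel (G : SimpleGraph V) (r : V) (idx : V → ℕ) (x : V) : ℕ :=
  sSup {k | ∃ y, Down G r x y ∧ label idx (side G y x) = k}

open Classical in
/-- The neighbor of `x` towards `r` across the halfspace with the largest label. -/
noncomputable def father (G : SimpleGraph V) (r : V) (idx : V → ℕ) (x : V) : V :=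
  if h : ∃ y, Down G r x y ∧ label idx (side G y x) = maxLabel G r idx x then h.choose else x

namespace IsMedian

variable (hG : IsMedian G) {r : V}

include hG

theorem exists_down {x : V} (hx : x ≠ r) : ∃ y, Down G r x y := by
  obtain ⟨y, hxy, hd⟩ := hG.exists_adj_closer hx
  exact ⟨y, hxy, by rw [G.dist_comm (u := r), G.dist_comm (u := r), hd]⟩

omit hG in
theorem _root_.MedianGraph.Down.away {x y : V} (h : Down G r x y) :
    AwayHalfspace G r (side G y x) :=
  ⟨by rw [mem_side, h.2]; omega, y, x, h.1.symm, rfl⟩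

omit hG in
theorem _root_.MedianGraph.Down.ne_root {x y : V} (h : Down G r x y) : x ≠ r := by
  rintro rfl
  have := h.2
  simp at this

theorem down_or_down {x y : V} (h : G.Adj x y) : Down G r x y ∨ Down G r y x := by
  rcases hG.dist_adj h r with h1 | h1
  · exact Or.inl ⟨h, h1⟩
  · exact Or.inr ⟨h.symm, h1⟩

theorem down_square {x y z : V} (hy : Down G r x y) (hz : Down G r x z) (hyz : y ≠ z) :
    ∃ c, Down G r y c ∧ Down G r z c ∧ IsSquare G x y c z := by
  obtain ⟨c, h1, h2, h3⟩ := hG.quadrangle hy.1 hz.1 hyz hy.2 hz.2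
  have h4 := hy.2
  have h5 := hz.2
  exact ⟨c, ⟨h1, h3⟩, ⟨h2, by omega⟩, hy.1, h1, h2.symm, hz.1.symm, by rintro rfl; omega, hyz⟩

/-- Edges from x to distinct neighbors belong to different classes: z is at distance 1 from x and,
by bipartiteness, at distance at least 2 from y, hence on the side of x in the edge xy. -/
theorem eq_of_side_eq {x y z : V} (hy : G.Adj x y) (hz : G.Adj x z)
    (h : side G y x = side G z x) : y = z := by
  by_contra hne
  have h1 : z ∉ side G y x := h ▸ left_notMem_side
  rw [mem_side, SimpleGraph.dist_eq_one_iff_adj.2 hz.symm] at h1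
  have h2 := hG.dist_ne_of_adj hy z
  rw [SimpleGraph.dist_eq_one_iff_adj.2 hz.symm] at h2
  have h3 := hG.1.pos_dist_of_ne (Ne.symm hne)
  omega

/-- A halfspace that can be left towards `r` at a down-neighbor `y` of `x`, but not at `x`,
contains the halfspace between `y` and `x`. -/
theorem side_ssubset {x y z : V} (hy : Down G r x y) (hz : Down G r y z)
    (h : ∀ y', Down G r x y' → side G y' x ≠ side G z y) : side G y x ⊂ side G z y := by
  refine ⟨fun u hu => by_contra fun hu' => ?_,
    fun hc => left_notMem_side (hc (mem_side_right hz.1.symm))⟩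
  -- A vertex u violating the inclusion yields a median c of x, z, u that is on the side of z in yz
  -- and on the side of x in xy. It closes a square with x, y, z, so the class of yz already leaves
  -- x towards r, through c.
  obtain ⟨c, h1, h2, h3⟩ := hG.exists_median x z u
  have hu'' := hu'
  rw [← Set.mem_compl_iff, hG.side_compl hz.1.symm] at hu'
  have hcz := hG.side_convex hz.1 (mem_side_right hz.1) hu' h2
  have hcx := hG.side_convex hy.1.symm hu (mem_side_right hy.1.symm) h3
  have a1 := SimpleGraph.dist_eq_one_iff_adj.2 hy.1
  have a2 := SimpleGraph.dist_eq_one_iff_adj.2 hz.1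
  have a3 := hG.dist_triangle x y z
  have a4 := hy.2
  have a5 := hz.2
  have a6 := SimpleGraph.dist_eq_one_iff_adj.2 hz.1.symm
  have hxzy : x ∈ side G z y := by
    rw [hG.mem_side_iff hz.1.symm, a1]
    have := hG.dist_adj hz.1 x
    have : x ≠ z := by rintro rfl; omega
    have := hG.1.pos_dist_of_ne this
    omega
  have hzc : z ≠ c := by
    rintro rfl
    rw [mem_side, a6] at hcx
    have b1 := G.dist_comm (u := x) (v := z)
    have b2 := (hG.mem_side_iff hz.1.symm).1 hxzy
    omega
  have hxc : x ≠ c := by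
    rintro rfl
    rw [mem_side] at hcz hxzy
    omega
  have hyc : y ≠ c := by
    rintro rfl
    exact left_notMem_side hcx
  have c1 := hG.1.pos_dist_of_ne hzc
  have c2 := hG.1.pos_dist_of_ne hxc
  have c3 := G.dist_comm (u := z) (v := c)
  have hxc' : G.Adj x c := SimpleGraph.dist_eq_one_iff_adj.1 (by omega)
  have hzc' : G.Adj z c := SimpleGraph.dist_eq_one_iff_adj.1 (by omega)
  have hdc : Down G r x c := by
    have := hG.dist_adj hxc' r
    have := hG.dist_adj hzc' r
    exact ⟨hxc', by omega⟩
  have hsq : IsSquare G c x y z :=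
    ⟨hxc'.symm, hy.1, hz.1, hzc', hyc.symm, by rintro rfl; omega⟩
  exact h c hdc (hG.side_eq_of_square hsq)

variable {idx : V → ℕ} (hidx : IsBFSNumbering G r idx)

include hidx

/-- The gate of `r` in a halfspace has the smallest number. -/
theorem exists_root_gate {H : Set V} (hH : AwayHalfspace G r H) : ∃ g c, Down G r g c ∧
    H = side G c g ∧ label idx H = idx g ∧ ∀ z ∈ H, G.dist r g + G.dist g z = G.dist r z := by
  obtain ⟨hr, u, v, huv, rfl⟩ := hH
  obtain ⟨g, hg, hgate⟩ := hG.exists_gate huv r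
  obtain ⟨c, hc⟩ := hG.exists_down (r := r) (x := g) (by rintro rfl; exact hr hg)
  have hcn : c ∉ side G u v := fun h => by
    have := hgate c h
    have := hc.2
    omega
  refine ⟨g, c, hc, hG.side_eq_of_crossing huv hc.1.symm hcn hg, ?_, hgate⟩
  refine le_antisymm (Nat.sInf_le ⟨g, hg, rfl⟩) (le_csInf ⟨_, g, hg, rfl⟩ ?_)
  rintro _ ⟨z, hz, rfl⟩
  have h1 := hgate z hz
  rcases (G.dist g z).eq_zero_or_pos with h2 | h2
  · rw [hG.1.dist_eq_zero_iff] at h2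
    rw [h2]
  · exact (hidx.lt_of_dist_lt _ _ (by omega)).le

/-- Equal labels mean equal gates g. No vertex of either halfspace is closer to r than g, so the
edge from g towards r crosses both, and a crossing edge determines the halfspace. -/
theorem label_injective {H K : Set V} (hH : AwayHalfspace G r H) (hK : AwayHalfspace G r K)
    (h : label idx H = label idx K) : H = K := by
  obtain ⟨g, c, h1, h2, h3, h4⟩ := hG.exists_root_gate hidx hH
  obtain ⟨g', c', h1', h2', h3', h4'⟩ := hG.exists_root_gate hidx hK
  obtain rfl : g = g' := hidx.injective (by rw [← h3, ← h3', h])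
  have hc : c ∉ K := fun hc => by
    have := h4' c hc
    have := h1.2
    omega
  have hg : g ∈ K := h2' ▸ mem_side_right h1'.1.symm
  obtain ⟨_, u, v, huv, rfl⟩ := hK
  rw [hG.side_eq_of_crossing huv h1.1.symm hc hg, h2]

theorem label_pos {H : Set V} (hH : AwayHalfspace G r H) : 0 < label idx H := by
  obtain ⟨g, c, h1, h2, h3, h4⟩ := hG.exists_root_gate hidx hH
  rw [h3]
  refine (Nat.zero_le _).trans_lt (hidx.lt_of_dist_lt c g ?_)
  have := h1.2
  omega

theorem label_lt_of_ssubset {H K : Set V} (hH : AwayHalfspace G r H) (hK : AwayHalfspace G r K)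
    (h : H ⊂ K) : label idx K < label idx H := by
  refine lt_of_le_of_ne (csInf_le_csInf ?_ ?_ (Set.image_mono h.1)) fun he =>
    h.ne (hG.label_injective hidx hH hK he.symm)
  · exact OrderBot.bddBelow _
  · obtain ⟨g, c, h1, h2, -⟩ := hG.exists_root_gate hidx hH
    exact ⟨_, g, h2 ▸ mem_side_right h1.1.symm, rfl⟩

omit hG hidx in
theorem maxLabel_root : maxLabel G r idx r = 0 := by
  have : {k | ∃ y, Down G r r y ∧ label idx (side G y r) = k} = ∅ := by
    ext k
    simp only [Set.mem_ofPred_eq, Set.mem_empty_iff_false, iff_false, not_exists, not_and]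
    intro y hy
    exact absurd rfl hy.ne_root
  rw [maxLabel, this]
  simp

omit hG hidx in
theorem father_root : father G r idx r = r := by
  rw [father, dif_neg]
  rintro ⟨y, hy, -⟩
  exact hy.ne_root rfl

omit hG hidx in
theorem bddAbove_labels (x : V) :
    BddAbove {k | ∃ y, Down G r x y ∧ label idx (side G y x) = k} := by
  refine ⟨idx x, ?_⟩
  rintro _ ⟨y, hy, rfl⟩
  exact Nat.sInf_le ⟨x, mem_side_right hy.1.symm, rfl⟩

omit hG hidx in
theorem label_le_maxLabel {x y : V} (hy : Down G r x y) :
    label idx (side G y x) ≤ maxLabel G r idx x :=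
  le_csSup (bddAbove_labels x) ⟨y, hy, rfl⟩

omit hidx in
theorem father_spec {x : V} (hx : x ≠ r) : Down G r x (father G r idx x) ∧
    label idx (side G (father G r idx x) x) = maxLabel G r idx x := by
  obtain ⟨y, hy⟩ := hG.exists_down hx
  have h := Nat.sSup_mem (s := {k | ∃ y, Down G r x y ∧ label idx (side G y x) = k})
    ⟨_, y, hy, rfl⟩ (bddAbove_labels x)
  have h' : ∃ y, Down G r x y ∧ label idx (side G y x) = maxLabel G r idx x := h
  rw [father, dif_pos h']
  exact h'.choose_spec

omit hidx in
theorem maxLabel_le (x : V) : maxLabel G r idx x ≤ idx x := by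
  by_cases hx : x = r
  · rw [hx, maxLabel_root]
    exact Nat.zero_le _
  · obtain ⟨h1, h2⟩ := hG.father_spec hx
    rw [← h2]
    exact Nat.sInf_le ⟨x, mem_side_right h1.1.symm, rfl⟩

theorem father_lt {x : V} (hx : x ≠ r) : idx (father G r idx x) < idx x := by
  have h := (hG.father_spec (idx := idx) hx).1.2
  exact hidx.lt_of_dist_lt _ _ (by omega)

/-- The numbers alone tell which edges lead towards r, so the program never needs the distances. -/
theorem down_iff {x y : V} (h : G.Adj x y) : Down G r x y ↔ idx y < idx x := by
  refine ⟨fun hd => hidx.lt_of_dist_lt _ _ (by have := hd.2; omega), fun hlt => ?_⟩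
  refine (hG.down_or_down h).resolve_right fun hd => ?_
  have := hidx.lt_of_dist_lt x y (by have := hd.2; omega)
  omega

/-- Let z be the father of the father y of x. If the class of yz is also left at x, its label is at
most the maximum at x, and differs from it because y lies in only one of the two halfspaces.
Otherwise the halfspace between y and x is strictly smaller, so its label is larger. -/
theorem maxLabel_father_lt {x : V} (hx : x ≠ r) :
    maxLabel G r idx (father G r idx x) < maxLabel G r idx x := by
  obtain ⟨h1, h2⟩ := hG.father_spec hx
  set y := father G r idx x
  by_cases hy : y = r
  · rw [hy, maxLabel_root, ← h2]
    exact hG.label_pos hidx h1.away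
  obtain ⟨h3, h4⟩ := hG.father_spec hy
  set z := father G r idx y
  by_cases hc : ∀ y', Down G r x y' → side G y' x ≠ side G z y
  · rw [← h4, ← h2]
    exact hG.label_lt_of_ssubset hidx h1.away h3.away (hG.side_ssubset h1 h3 hc)
  · push Not at hc
    obtain ⟨y', h5, h6⟩ := hc
    refine lt_of_le_of_ne (by rw [← h4, ← h6]; exact label_le_maxLabel h5) fun he => ?_
    rw [← h4, ← h2] at he
    have := hG.label_injective hidx h3.away h1.away he
    exact left_notMem_side (this ▸ mem_side_right h3.1.symm)

/-- The square spanned by x, y and the father of x repeats the maximal class of x at y, which gives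
one inequality. For the other, a class left at y is either left at x too, or its halfspace contains
the one between y and x and has a smaller label. -/
theorem maxLabel_eq {x y : V} (hy : Down G r x y) (hne : y ≠ father G r idx x) :
    maxLabel G r idx y = maxLabel G r idx x := by
  obtain ⟨h1, h2⟩ := hG.father_spec hy.ne_root
  set a := father G r idx x
  obtain ⟨c, h3, h4, h5⟩ := hG.down_square hy h1 hne
  have hs : side G a x = side G c y := by
    obtain ⟨b1, b2, b3, b4, b5, b6⟩ := h5
    exact hG.side_eq_of_square ⟨b4, b1, b2, b3, b6.symm, b5⟩
  apply le_antisymm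
  · obtain ⟨h6, h7⟩ := hG.father_spec h3.ne_root
    set z := father G r idx y
    rw [← h7]
    by_cases hc : ∀ y', Down G r x y' → side G y' x ≠ side G z y
    · exact (hG.label_lt_of_ssubset hidx hy.away h6.away (hG.side_ssubset hy h6 hc)).le.trans
        (label_le_maxLabel hy)
    · push Not at hc
      obtain ⟨y', h8, h9⟩ := hc
      rw [← h9]
      exact label_le_maxLabel h8
  · rw [← h2, hs]
    exact label_le_maxLabel h3

/-- Here x is itself the gate of r in the halfspace between y and x: a first step from x to another
gate would lead towards r inside the halfspace by convexity, but the only such step is to y, which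
is outside. -/
theorem maxLabel_eq_idx {x y : V} (hy : Down G r x y) (huniq : ∀ z, Down G r x z → z = y) :
    maxLabel G r idx x = idx x := by
  obtain ⟨h1, h2⟩ := hG.father_spec hy.ne_root
  obtain ⟨g, c, h3, h4, h5, h6⟩ := hG.exists_root_gate hidx h1.away
  rw [huniq _ h1] at h2 h4 h5 h6
  rw [← h2, h5]
  by_contra hne
  have hxg : x ≠ g := by rintro rfl; exact hne rfl
  obtain ⟨z, hxz, hz⟩ := hG.exists_adj_closer hxg
  have hx : x ∈ side G y x := mem_side_right hy.1.symm
  have hg : g ∈ side G y x := h4 ▸ mem_side_right h3.1.symm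
  have a1 := h6 x hx
  have a2 := hG.dist_triangle r g z
  have a3 := hG.dist_adj hxz r
  have a4 := G.dist_comm (u := g) (v := z)
  have a5 := G.dist_comm (u := g) (v := x)
  have a6 := SimpleGraph.dist_eq_one_iff_adj.2 hxz
  have hzy := huniq z ⟨hxz, by omega⟩
  have hz' := hG.side_convex hy.1.symm hx hg (z := z) (by omega)
  exact left_notMem_side (hzy ▸ hz')

/-- The father and the label of a vertex can be found from the labels of its down-neighbors. -/
theorem scan_spec {x b : V} {mn mx N : ℕ} (hmin : (b = x ∧ mn = N ∧ ∀ y, ¬ Down G r x y) ∨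
      (Down G r x b ∧ mn = maxLabel G r idx b))
    (hall : ∀ y, Down G r x y → mn ≤ maxLabel G r idx y ∧ maxLabel G r idx y ≤ mx)
    (hmax : mx = 0 ∨ ∃ y, Down G r x y ∧ maxLabel G r idx y = mx) :
    father G r idx x = b ∧ maxLabel G r idx x = if mn < mx then mx else idx x := by
  -- Only the root has no down-neighbor; then `mx` is 0 and the conditional falls through to the
  -- number of the root, 0.
  rcases hmin with ⟨rfl, rfl, hno⟩ | ⟨hb, hmn⟩
  · obtain rfl : b = r := by
      by_contra hr
      obtain ⟨y, hy⟩ := hG.exists_down hr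
      exact hno y hy
    have hmx : mx = 0 := hmax.resolve_right fun ⟨y, hy, _⟩ => hno y hy
    rw [father_root, maxLabel_root, hmx, hidx.root]
    simp
  · have hx := hb.ne_root
    have hf := (hG.father_spec (idx := idx) hx).1
    have hlt := hG.maxLabel_father_lt hidx hx
    have h1 := hall _ hf
    have hfb : father G r idx x = b := by
      by_contra hne
      have := hG.maxLabel_eq hidx hb (Ne.symm hne)
      omega
    refine ⟨hfb, ?_⟩
    rw [hfb] at hf hlt h1
    -- With one down-neighbor, minimum and maximum coincide and the label is the number of x. With
    -- more, the father gives the strict minimum and all the others give the label of x.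
    by_cases hu : ∀ z, Down G r x z → z = b
    · rw [hG.maxLabel_eq_idx hidx hb hu, if_neg]
      rcases hmax with h2 | ⟨y, hy, h2⟩
      · omega
      · rw [hu y hy] at h2
        omega
    · push Not at hu
      obtain ⟨z, hz, hzb⟩ := hu
      have h3 := hG.maxLabel_eq hidx hz (hfb ▸ hzb)
      have h4 := hall z hz
      rw [if_pos (by omega)]
      rcases hmax with h2 | ⟨y, hy, h2⟩
      · omega
      · by_cases hyb : y = b
        · rw [hyb] at h2
          omega
        · have := hG.maxLabel_eq hidx hy (hfb ▸ hyb)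
          omega

/-- An edge that is not in the tree of fathers is opposite to the edge between the fathers. -/
theorem father_square {x v : V} (h : Down G r x v) (hv : v ≠ father G r idx x) :
    G.Adj (father G r idx v) (father G r idx x) ∧
      IsSquare G v x (father G r idx x) (father G r idx v) := by
  obtain ⟨h1, h2⟩ := hG.father_spec h.ne_root
  have h0 := hG.maxLabel_eq hidx h hv
  set a := father G r idx x
  obtain ⟨c, h3, h4, h5⟩ := hG.down_square h h1 hv
  have hs : side G a x = side G c v := by
    obtain ⟨b1, b2, b3, b4, b5, b6⟩ := h5
    exact hG.side_eq_of_square ⟨b4, b1, b2, b3, b6.symm, b5⟩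
  obtain ⟨h6, h7⟩ := hG.father_spec h3.ne_root
  -- The edge vc repeats the class of the edge from x to its father, whose label is also maximal at
  -- v; at most one edge at v is in that class.
  have hc : c = father G r idx v := by
    refine hG.eq_of_side_eq h3.1 h6.1 (hG.label_injective hidx h3.away h6.away ?_)
    rw [← hs, h2, h7, h0]
  rw [← hc]
  obtain ⟨b1, b2, b3, b4, b5, b6⟩ := h5
  exact ⟨b3, b1.symm, b4.symm, b3.symm, b2.symm, b6, b5⟩

theorem side_eq_side_father {x v : V} (h : G.Adj v x) (h1 : father G r idx x ≠ v)
    (h2 : father G r idx v ≠ x) : G.Adj (father G r idx v) (father G r idx x) ∧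
      side G v x = side G (father G r idx v) (father G r idx x) := by
  rcases hG.down_or_down (r := r) h with hd | hd
  · obtain ⟨h3, h4⟩ := hG.father_square hidx hd h2.symm
    refine ⟨h3.symm, ?_⟩
    rw [← hG.side_compl h.symm, ← hG.side_compl h3, hG.side_eq_of_square h4]
  · obtain ⟨h3, h4⟩ := hG.father_square hidx hd h1.symm
    exact ⟨h3, hG.side_eq_of_square h4⟩

/-- Together with the next lemma this says that the tree edge above x crosses H exactly when the
label stored at x is that of H, and that it then leaves H. -/
theorem mem_of_maxLabel_eq {H : Set V} (hH : AwayHalfspace G r H) {x : V} (hx : x ≠ r)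
    (h : maxLabel G r idx x = label idx H) : x ∈ H ∧ father G r idx x ∉ H := by
  obtain ⟨h1, h2⟩ := hG.father_spec hx
  rw [hG.label_injective hidx hH h1.away (by rw [h2, h])]
  exact ⟨mem_side_right h1.1.symm, left_notMem_side⟩

omit hidx in
-- A tree edge leaving H would carry the label of H. A tree edge entering H is impossible, since it
-- leads towards r and r is not in H.
theorem mem_iff_of_maxLabel_ne {H : Set V} (hH : AwayHalfspace G r H) {x : V} (hx : x ≠ r)
    (h : maxLabel G r idx x ≠ label idx H) : x ∈ H ↔ father G r idx x ∈ H := by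
  obtain ⟨h1, h2⟩ := hG.father_spec hx
  obtain ⟨hr, u, v, huv, rfl⟩ := hH
  constructor <;> intro h3 <;> by_contra h4
  · exact h (by rw [← h2, ← hG.side_eq_of_crossing huv h1.1.symm h4 h3])
  · rw [hG.side_eq_of_crossing huv h1.1 h4 h3, mem_side] at hr
    have := h1.2
    omega

end IsMedian

end MedianGraph

/-! ### Program logic: frames, weakest preconditions and loops -/

namespace RealRAM

namespace State

/-- The state after assigning `c` to the word variable `x`. -/
def setVar (s : State) (x c : ℕ) : State :=
  { s with var := Function.update s.var x c }

/-- The state after storing `c` at position `i` of the word array `a`. -/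
def setArr (s : State) (a i c : ℕ) : State :=
  { s with arr := Function.update s.arr a (Function.update (s.arr a) i c) }

/-- The state after assigning `c` to the real variable `x`. -/
def setRVar (s : State) (x : ℕ) (c : ℝ) : State :=
  { s with rvar := Function.update s.rvar x c }

/-- The state after storing `c` at position `i` of the real array `a`. -/
def setRArr (s : State) (a i : ℕ) (c : ℝ) : State :=
  { s with rarr := Function.update s.rarr a (Function.update (s.rarr a) i c) }

section

variable (s : State) (x y a b i j c : ℕ) (d : ℝ)

@[simp] theorem setVar_var : (s.setVar x c).var y = if y = x then c else s.var y := by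
  simp [setVar, Function.update_apply]
@[simp] theorem setVar_arr : (s.setVar x c).arr = s.arr := rfl
@[simp] theorem setVar_rvar : (s.setVar x c).rvar = s.rvar := rfl
@[simp] theorem setVar_rarr : (s.setVar x c).rarr = s.rarr := rfl

@[simp] theorem setArr_arr :
    (s.setArr a i c).arr b j = if b = a ∧ j = i then c else s.arr b j := by
  rcases eq_or_ne b a with rfl | h
  · simp [setArr, Function.update_apply]
  · simp [setArr, h]
@[simp] theorem setArr_var : (s.setArr a i c).var = s.var := rfl
@[simp] theorem setArr_rarr : (s.setArr a i c).rarr = s.rarr := rfl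

@[simp] theorem setRVar_rvar : (s.setRVar x d).rvar y = if y = x then d else s.rvar y := by
  simp [setRVar, Function.update_apply]

@[simp] theorem setRArr_rarr :
    (s.setRArr a i d).rarr b j = if b = a ∧ j = i then d else s.rarr b j := by
  rcases eq_or_ne b a with rfl | h
  · simp [setRArr, Function.update_apply]
  · simp [setRArr, h]
@[simp] theorem setRArr_var : (s.setRArr a i d).var = s.var := rfl
@[simp] theorem setRArr_arr : (s.setRArr a i d).arr = s.arr := rfl

end

end State

namespace Prog

/-- The word variables assigned by a program. -/
def vars : Prog → List ℕ
  | assign x _ => [x]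
  | seq p q => p.vars ++ q.vars
  | ite _ p q => p.vars ++ q.vars
  | loop _ p => p.vars
  | _ => []

/-- The word arrays written by a program. -/
def arrs : Prog → List ℕ
  | store a _ _ => [a]
  | seq p q => p.arrs ++ q.arrs
  | ite _ p q => p.arrs ++ q.arrs
  | loop _ p => p.arrs
  | _ => []

/-- The real variables assigned by a program. -/
def rvars : Prog → List ℕ
  | rassign x _ => [x]
  | seq p q => p.rvars ++ q.rvars
  | ite _ p q => p.rvars ++ q.rvars
  | loop _ p => p.rvars
  | _ => []

/-- The real arrays written by a program. -/
def rarrs : Prog → List ℕ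
  | rstore a _ _ => [a]
  | seq p q => p.rarrs ++ q.rarrs
  | ite _ p q => p.rarrs ++ q.rarrs
  | loop _ p => p.rarrs
  | _ => []

/-- The weakest precondition of a loop-free program. -/
def wp (B : ℕ) : Prog → (State → Prop) → State → Prop
  | skip, Q, s => Q s
  | assign x e, Q, s => e.Fits B s ∧ Q (s.setVar x (e.eval s))
  | store a i e, Q, s => i.Fits B s ∧ e.Fits B s ∧ Q (s.setArr a (i.eval s) (e.eval s))
  | rassign x e, Q, s => e.Fits B s ∧ Q (s.setRVar x (e.eval s))
  | rstore a i e, Q, s => i.Fits B s ∧ e.Fits B s ∧ Q (s.setRArr a (i.eval s) (e.eval s))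
  | seq p q, Q, s => p.wp B (q.wp B Q) s
  | ite b p q, Q, s => b.Fits B s ∧ (b.eval s → p.wp B Q s) ∧ (¬ b.eval s → q.wp B Q s)
  | loop _ _, _, _ => False

/-- An upper bound for the cost of a loop-free program. -/
def maxCost : Prog → ℕ
  | skip => 1
  | assign _ e => e.cost + 1
  | store _ i e => i.cost + e.cost + 1
  | rassign _ e => e.cost + 1
  | rstore _ i e => i.cost + e.cost + 1
  | seq p q => p.maxCost + q.maxCost
  | ite b p q => b.cost + (p.maxCost + q.maxCost)
  | loop _ _ => 0

/-- `for x < e do p`, with the loop variable `x` starting at its current value. -/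
def forLoop (x e : ℕ) (p : Prog) : Prog :=
  .loop (.lt (.var x) (.var e)) (.seq p (.assign x (.add (.var x) (.lit 1))))

end Prog

/-- The two states agree on everything that `p` does not write. -/
structure Agree (p : Prog) (s s' : State) : Prop where
  var : ∀ x, x ∉ p.vars → s'.var x = s.var x
  arr : ∀ a, a ∉ p.arrs → s'.arr a = s.arr a
  rvar : ∀ x, x ∉ p.rvars → s'.rvar x = s.rvar x
  rarr : ∀ a, a ∉ p.rarrs → s'.rarr a = s.rarr a

theorem Agree.refl (p : Prog) (s : State) : Agree p s s :=
  ⟨fun _ _ => rfl, fun _ _ => rfl, fun _ _ => rfl, fun _ _ => rfl⟩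

theorem Agree.trans {p : Prog} {s s' s'' : State} (h : Agree p s s') (h' : Agree p s' s'') :
    Agree p s s'' :=
  ⟨fun x hx => (h'.var x hx).trans (h.var x hx), fun x hx => (h'.arr x hx).trans (h.arr x hx),
    fun x hx => (h'.rvar x hx).trans (h.rvar x hx), fun x hx => (h'.rarr x hx).trans (h.rarr x hx)⟩

theorem Agree.mono {p q : Prog} {s s' : State} (h : Agree p s s') (h1 : p.vars ⊆ q.vars)
    (h2 : p.arrs ⊆ q.arrs) (h3 : p.rvars ⊆ q.rvars) (h4 : p.rarrs ⊆ q.rarrs) : Agree q s s' :=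
  ⟨fun x hx => h.var x fun hc => hx (h1 hc), fun x hx => h.arr x fun hc => hx (h2 hc),
    fun x hx => h.rvar x fun hc => hx (h3 hc), fun x hx => h.rarr x fun hc => hx (h4 hc)⟩

/-- The frame rule. Membership in the finite write lists is decidable, so the preservation of
untouched memory costs one `decide` each time. -/
theorem Exec.agree {B t : ℕ} {p : Prog} {s s' : State} (h : Exec B p s t s') :
    Agree p s s' := by
  induction h with
  | skip s => exact .refl _ _
  | assign x e s he =>
    exact ⟨fun y hy => Function.update_of_ne (by simpa [Prog.vars] using hy) _ _,
      fun _ _ => rfl, fun _ _ => rfl, fun _ _ => rfl⟩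
  | store a i e s hi he =>
    exact ⟨fun _ _ => rfl, fun y hy => Function.update_of_ne (by simpa [Prog.arrs] using hy) _ _,
      fun _ _ => rfl, fun _ _ => rfl⟩
  | rassign x e s he =>
    exact ⟨fun _ _ => rfl, fun _ _ => rfl,
      fun y hy => Function.update_of_ne (by simpa [Prog.rvars] using hy) _ _, fun _ _ => rfl⟩
  | rstore a i e s hi he =>
    exact ⟨fun _ _ => rfl, fun _ _ => rfl, fun _ _ => rfl,
      fun y hy => Function.update_of_ne (by simpa [Prog.rarrs] using hy) _ _⟩
  | seq p q s s' s'' t t' hp hq ihp ihq =>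
    exact (ihp.mono (List.subset_append_left _ _) (List.subset_append_left _ _)
      (List.subset_append_left _ _) (List.subset_append_left _ _)).trans
      (ihq.mono (List.subset_append_right _ _) (List.subset_append_right _ _)
      (List.subset_append_right _ _) (List.subset_append_right _ _))
  | ite_true b p q s s' t hf hb hp ih =>
    exact ih.mono (List.subset_append_left _ _) (List.subset_append_left _ _)
      (List.subset_append_left _ _) (List.subset_append_left _ _)
  | ite_false b p q s s' t hf hb hq ih =>
    exact ih.mono (List.subset_append_right _ _) (List.subset_append_right _ _)
      (List.subset_append_right _ _) (List.subset_append_right _ _)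
  | loop_done b p s hf hb => exact .refl _ _
  | loop_step b p s s' s'' t t' hf hb hp hl ihp ihl =>
    exact Agree.trans ⟨ihp.var, ihp.arr, ihp.rvar, ihp.rarr⟩ ihl

/-- Started in `s`, the program `p` halts after at most `t` operations, and the final state
satisfies `Q`. -/
def Runs (B : ℕ) (p : Prog) (s : State) (t : ℕ) (Q : State → Prop) : Prop :=
  ∃ t' s', Exec B p s t' s' ∧ t' ≤ t ∧ Q s'

namespace Runs

variable {B t t₁ t₂ : ℕ} {p q : Prog} {s : State} {Q Q' : State → Prop}

theorem mono (h : Runs B p s t₁ Q) (ht : t₁ ≤ t₂) (hQ : ∀ s', Agree p s s' → Q s' → Q' s') :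
    Runs B p s t₂ Q' := by
  obtain ⟨t', s', he, ht', hq⟩ := h
  exact ⟨t', s', he, ht'.trans ht, hQ s' he.agree hq⟩

theorem seq (h : Runs B p s t₁ fun s' => Agree p s s' → Runs B q s' t₂ Q) :
    Runs B (.seq p q) s (t₁ + t₂) Q := by
  obtain ⟨t', s', he, ht', hq⟩ := h
  obtain ⟨t'', s'', he', ht'', hq'⟩ := hq he.agree
  exact ⟨t' + t'', s'', .seq _ _ _ _ _ _ _ he he', add_le_add ht' ht'', hq'⟩

theorem of_wp (h : p.wp B Q s) : Runs B p s p.maxCost Q := by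
  induction p generalizing s Q with
  | skip => exact ⟨_, _, .skip s, le_rfl, h⟩
  | assign x e => exact ⟨_, _, .assign x e s h.1, le_rfl, h.2⟩
  | store a i e => exact ⟨_, _, .store a i e s h.1 h.2.1, le_rfl, h.2.2⟩
  | rassign x e => exact ⟨_, _, .rassign x e s h.1, le_rfl, h.2⟩
  | rstore a i e => exact ⟨_, _, .rstore a i e s h.1 h.2.1, le_rfl, h.2.2⟩
  | seq p q ihp ihq => exact seq ((ihp h).mono le_rfl fun s' _ h' _ => ihq h')
  | ite b p q ihp ihq =>
    obtain ⟨hf, h1, h2⟩ := h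
    by_cases hb : b.eval s
    · obtain ⟨t', s', he, ht', hq⟩ := ihp (h1 hb)
      exact ⟨_, s', .ite_true _ _ _ _ _ _ hf hb he, by simp only [Prog.maxCost]; omega, hq⟩
    · obtain ⟨t', s', he, ht', hq⟩ := ihq (h2 hb)
      exact ⟨_, s', .ite_false _ _ _ _ _ _ hf hb he, by simp only [Prog.maxCost]; omega, hq⟩
  | loop b p => exact h.elim

theorem ite {b : Test} (hf : b.Fits B s) (h1 : b.eval s → Runs B p s t₁ Q)
    (h2 : ¬ b.eval s → Runs B q s t₂ Q) (ht₁ : b.cost + t₁ ≤ t) (ht₂ : b.cost + t₂ ≤ t) :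
    Runs B (.ite b p q) s t Q := by
  by_cases hb : b.eval s
  · obtain ⟨t', s', he, ht', hq⟩ := h1 hb
    exact ⟨_, s', .ite_true _ _ _ _ _ _ hf hb he, by omega, hq⟩
  · obtain ⟨t', s', he, ht', hq⟩ := h2 hb
    exact ⟨_, s', .ite_false _ _ _ _ _ _ hf hb he, by omega, hq⟩

/-- A loop whose invariant `I i T` refers to the loop variable `i` and the elapsed time `T`. -/
theorem forLoop_time {x e a b : ℕ} (I : ℕ → ℕ → State → Prop)
    (hx : s.var x = a) (he : s.var e = b) (hab : a ≤ b) (hB : b < B)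
    (hxp : x ∉ p.vars) (hep : e ∉ p.vars) (hne : e ≠ x) (h0 : I a 0 s)
    (hstep : ∀ i T, a ≤ i → i < b → ∀ s', Agree (.forLoop x e p) s s' → s'.var x = i → I i T s' →
      ∃ c, Runs B p s' c fun s'' =>
        I (i + 1) (T + (c + 7)) (s''.setVar x (i + 1)))
    (hend : ∀ s' T, Agree (.forLoop x e p) s s' → I b T s' → T + 3 ≤ t ∧ Q s') :
    Runs B (.forLoop x e p) s t Q := by
  have main : ∀ k i T s', i + k = b → a ≤ i → Agree (.forLoop x e p) s s' → s'.var x = i →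
      I i T s' → ∃ t' s'', Exec B (.forLoop x e p) s' t' s'' ∧ T + t' ≤ t ∧ Q s'' := by
    intro k
    induction k with
    | zero =>
      intro i T s' hik hai hag hi hI
      have hes : s'.var e = b := by
        rw [hag.var e (by simp [Prog.forLoop, Prog.vars, hep, hne]), he]
      obtain ⟨h1, h2⟩ := hend s' T hag ((show i = b by omega) ▸ hI)
      exact ⟨_, s', .loop_done _ _ _ ⟨show s'.var x ≤ B by omega, show s'.var e ≤ B by omega⟩
        (show ¬ s'.var x < s'.var e by omega), h1, h2⟩
    | succ k ih =>
      intro i T s' hik hai hag hi hI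
      have hes : s'.var e = b := by
        rw [hag.var e (by simp [Prog.forLoop, Prog.vars, hep, hne]), he]
      obtain ⟨c, t', s'', h1, h2, h3⟩ := hstep i T hai (by omega) s' hag hi hI
      have hx' : s''.var x = i := by rw [h1.agree.var x hxp, hi]
      -- The increment costs 4 and the loop test 3, whence the 7 added to each round; the last,
      -- failing test accounts for the final 3.
      have h4 : Exec B (.assign x (.add (.var x) (.lit 1))) s'' 4
          (s''.setVar x (i + 1)) := by
        have := Exec.assign (B := B) x (.add (.var x) (.lit 1)) s''
          ⟨show s''.var x ≤ B by omega, show 1 ≤ B by omega, show s''.var x + 1 ≤ B by omega⟩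
        simpa [Exp.eval, Exp.cost, hx', State.setVar] using this
      have h5 := Exec.seq _ _ _ _ _ _ _ h1 h4
      obtain ⟨t₃, s₃, h6, h7, h8⟩ := ih (i + 1) _ _ (by omega) (by omega)
        (hag.trans ⟨h5.agree.var, h5.agree.arr, h5.agree.rvar, h5.agree.rarr⟩)
        (by simp) h3
      refine ⟨_, s₃, .loop_step _ _ _ _ _ _ _
        ⟨show s'.var x ≤ B by omega, show s'.var e ≤ B by omega⟩
        (show s'.var x < s'.var e by omega) h5 h6, ?_, h8⟩
      simp only [Test.cost, Exp.cost]
      omega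
  obtain ⟨t', s', h1, h2, h3⟩ := main (b - a) a 0 s (by omega) le_rfl (.refl _ _) hx h0
  exact ⟨t', s', h1, by omega, h3⟩

/-- The special case in which the cost of round i is known in advance, so that the time need not
enter the invariant. -/
theorem forLoop {x e a b : ℕ} (I : ℕ → State → Prop) (c : ℕ → ℕ)
    (hx : s.var x = a) (he : s.var e = b) (hab : a ≤ b) (hB : b < B)
    (hxp : x ∉ p.vars) (hep : e ∉ p.vars) (hne : e ≠ x) (h0 : I a s)
    (hstep : ∀ i, a ≤ i → i < b → ∀ s', Agree (.forLoop x e p) s s' → s'.var x = i → I i s' →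
      Runs B p s' (c i) fun s'' =>
        I (i + 1) (s''.setVar x (i + 1)))
    (hend : ∀ s', Agree (.forLoop x e p) s s' → I b s' → Q s') :
    Runs B (.forLoop x e p) s (∑ i ∈ Finset.Ico a b, (c i + 7) + 3) Q := by
  refine forLoop_time (fun i T s' => I i s' ∧ T = ∑ j ∈ Finset.Ico a i, (c j + 7)) hx he hab hB
    hxp hep hne ⟨h0, by simp⟩ ?_ ?_
  · rintro i T hai hib s' hag hi ⟨hI, rfl⟩
    refine ⟨c i, (hstep i hai hib s' hag hi hI).mono le_rfl fun s'' _ h => ⟨h, ?_⟩⟩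
    rw [Finset.sum_Ico_succ_top hai]
  · rintro s' T hag ⟨hI, rfl⟩
    exact ⟨le_rfl, hend s' hag hI⟩

end Runs

infixr:60 " ;; " => Prog.seq

/-- `for p in start x, …, start (x+1) - 1 do body`: the loop over the positions of the adjacency
list of the vertex in word variable `x`. -/
def Prog.row (p e x : ℕ) (body : Prog) : Prog :=
  (.assign p (.get 0 (.var x)) ;; .assign e (.get 0 (.add (.var x) (.lit 1)))) ;;
    .forLoop p e body

/-- The test for equality of two words. -/
def Test.eq (e f : Exp) : Test := .and (.not (.lt e f)) (.not (.lt f e))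

attribute [simp] Prog.wp Exp.Fits Exp.eval RExp.Fits RExp.eval Test.Fits Test.eval Test.eq

end RealRAM

/-! ### Rows of the adjacency lists -/

namespace MedianGraph

open RealRAM

variable {n : ℕ} {G : SimpleGraph (Fin n)} {w : Fin n → ℝ} {s : State}

namespace IsInput

variable (hin : IsInput G w s)

include hin

theorem start_mono {i j : ℕ} (hij : i ≤ j) (hj : j ≤ n) : s.arr 0 i ≤ s.arr 0 j := by
  induction j, hij using Nat.le_induction with
  | base => exact le_rfl
  | succ j hij ih => exact (ih (by omega)).trans (hin.start_le ⟨j, hj⟩)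

theorem exists_neighbor {v : Fin n} {p : ℕ} (h1 : s.arr 0 v ≤ p)
    (h2 : p < s.arr 0 ((v : ℕ) + 1)) : ∃ u, G.Adj v u ∧ s.arr 1 p = u := by
  obtain ⟨u, hu, he⟩ := (hin.neighbors v).mapsTo ⟨h1, h2⟩
  exact ⟨u, hu, he.symm⟩

theorem exists_position {v u : Fin n} (h : G.Adj v u) : ∃ p, s.arr 0 v ≤ p ∧
    p < s.arr 0 ((v : ℕ) + 1) ∧ s.arr 1 p = u := by
  obtain ⟨p, hp, he⟩ := (hin.neighbors v).surjOn ⟨u, h, rfl⟩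
  exact ⟨p, hp.1, hp.2, he⟩

theorem eq_of_mem_rows {v v' : Fin n} {p : ℕ} (h1 : s.arr 0 v ≤ p)
    (h2 : p < s.arr 0 ((v : ℕ) + 1)) (h1' : s.arr 0 v' ≤ p)
    (h2' : p < s.arr 0 ((v' : ℕ) + 1)) : v = v' := by
  by_contra hne
  rcases lt_or_gt_of_ne hne with h | h
  · have := hin.start_mono (show (v : ℕ) + 1 ≤ v' from h) v'.2.le
    omega
  · have := hin.start_mono (show (v' : ℕ) + 1 ≤ v from h) v.2.le
    omega

theorem sum_len_eq_start : ∑ v : Fin n, (s.arr 0 ((v : ℕ) + 1) - s.arr 0 v) = s.arr 0 n := by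
  rw [Finset.sum_fin_eq_sum_range, Finset.sum_congr rfl (g := fun i => s.arr 0 (i + 1) - s.arr 0 i)
    (fun i hi => dif_pos (Finset.mem_range.1 hi))]
  have : ∀ k ≤ n, ∑ i ∈ Finset.range k, (s.arr 0 (i + 1) - s.arr 0 i) = s.arr 0 k := by
    intro k
    induction k with
    | zero => simp [hin.start_zero]
    | succ k ih =>
      intro hk
      rw [Finset.sum_range_succ, ih (by omega)]
      have := hin.start_mono (show k ≤ k + 1 by omega) hk
      omega
  exact this n le_rfl

theorem start_eq : s.arr 0 n = 2 * G.edgeSet.ncard := by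
  classical
  have h := G.sum_degrees_eq_twice_card_edges
  rw [← Set.ncard_coe_finset, SimpleGraph.coe_edgeFinset] at h
  rw [← hin.sum_len_eq_start, ← h]
  refine Finset.sum_congr rfl fun v _ => ?_
  have h1 := (hin.neighbors v).image_eq
  have h2 := (hin.neighbors v).injOn.ncard_image
  rw [h1, Set.ncard_image_of_injective _ Fin.val_injective, ← Finset.coe_Ico,
    Set.ncard_coe_finset, Nat.card_Ico] at h2
  rw [← h2, ← SimpleGraph.card_neighborSet_eq_degree, ← Nat.card_coe_set_eq,
    Nat.card_eq_fintype_card]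

theorem start_le_start {v : Fin n} : s.arr 0 ((v : ℕ) + 1) ≤ s.arr 0 n :=
  hin.start_mono (show (v : ℕ) + 1 ≤ n from v.2) le_rfl

theorem congr {s' : State} (h0 : s'.var 0 = s.var 0) (h1 : s'.arr 0 = s.arr 0)
    (h2 : s'.arr 1 = s.arr 1) (h3 : s'.rarr 0 = s.rarr 0) : IsInput G w s' where
  size := h0.trans hin.size
  start_zero := by rw [h1, hin.start_zero]
  start_le := by rw [h1]; exact hin.start_le
  neighbors := by rw [h1, h2]; exact hin.neighbors
  weights := by rw [h3]; exact hin.weights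

end IsInput

/-- The words up to `B` suffice for the vertices and the positions. -/
structure WordBound {n : ℕ} (B : ℕ) (s : State) : Prop where
  size : n + 2 ≤ B
  start : s.arr 0 n + 2 ≤ B

/-- The overhead 11 is 8 for setting the two bounds of the row and 3 for the last loop test. The
invariant therefore starts in the state with both bounds set. -/
theorem Runs.row {B p e x : ℕ} {body : Prog} {Q : State → Prop} (hin : IsInput G w s)
    (hB : WordBound (n := n) B s) (v : Fin n) (I : ℕ → State → Prop) (c : ℕ → ℕ)
    (hx : s.var x = v) (hxp : x ≠ p) (hep : e ≠ p)
    (hpb : p ∉ body.vars) (heb : e ∉ body.vars)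
    (h0 : I (s.arr 0 v) ((s.setVar p (s.arr 0 v)).setVar e (s.arr 0 ((v : ℕ) + 1))))
    (hstep : ∀ i, ∀ u : Fin n, s.arr 0 v ≤ i → i < s.arr 0 ((v : ℕ) + 1) → G.Adj v u →
      s.arr 1 i = u → ∀ s', Agree (.row p e x body) s s' → s'.var p = i → I i s' →
      Runs B body s' (c i) fun s'' =>
        I (i + 1) (s''.setVar p (i + 1)))
    (hend : ∀ s', Agree (.row p e x body) s s' → I (s.arr 0 ((v : ℕ) + 1)) s' → Q s') :
    Runs B (.row p e x body) s
      (∑ i ∈ Finset.Ico (s.arr 0 v) (s.arr 0 ((v : ℕ) + 1)), (c i + 7) + 11) Q := by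
  have hB1 := hB.size
  have hB2 := hB.start
  have h1 := hin.start_le_start (v := v)
  have h2 := hin.start_le v
  have h3 := v.2
  have hag : ∀ s', Agree (.forLoop p e body) ((s.setVar p (s.arr 0 v)).setVar e
      (s.arr 0 ((v : ℕ) + 1))) s' →
      Agree (.row p e x body) s s' := by
    intro s' h
    refine ⟨fun y hy => ?_, h.arr, h.rvar, h.rarr⟩
    simp only [Prog.row, Prog.vars, List.mem_append, List.mem_singleton, not_or] at hy
    rw [h.var y hy.2, State.setVar_var, if_neg hy.1.2, State.setVar_var, if_neg hy.1.1]
  rw [add_comm _ 11]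
  refine (Runs.seq (t₁ := 8) (t₂ := ∑ i ∈ Finset.Ico (s.arr 0 v) (s.arr 0 ((v : ℕ) + 1)),
    (c i + 7) + 3) (Q := Q) ((Runs.of_wp (Q := fun s' => s' = ((s.setVar p (s.arr 0 v)).setVar e
      (s.arr 0 ((v : ℕ) + 1))))
      ?_).mono le_rfl ?_)).mono (by omega) (fun _ _ h => h)
  · simp only [Prog.wp, Exp.Fits, Exp.eval, hx, State.setVar_var, if_neg hxp, State.setVar_arr,
      and_true]
    omega
  · rintro _ - rfl -
    refine Runs.forLoop (a := s.arr 0 v) (b := s.arr 0 ((v : ℕ) + 1)) I c ?_ ?_ h2 (by omega)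
      hpb heb hep h0 ?_ ?_
    · simp [hep.symm]
    · simp
    · intro i hi hi' s' ha hs hI
      obtain ⟨u, hu, hiu⟩ := hin.exists_neighbor hi hi'
      exact hstep i u hi hi' hu hiu s' (hag s' ha) hs hI
    · intro s' ha hI
      exact hend s' (hag s' ha) hI

/-! ### Initialization and breadth-first search -/

/-- Initializes the numbers, the weights to be moved, and the weights of the halfspaces. -/
def initProg : Prog :=
  .assign 2 (.lit 0) ;; .forLoop 2 0 (.store 5 (.var 2) (.lit 0) ;;
    .rstore 2 (.var 2) (.get 0 (.var 2)) ;;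
    .rstore 3 (.var 2) (.sub (.get 0 (.var 2)) (.get 0 (.var 2))))

/-- Real expressions have no literals, so the zeros of real array 3 are produced as w(v) - w(v). The
zeros of word array 5 mark unseen vertices. -/
theorem runs_initProg {B : ℕ} (hin : IsInput G w s) (hB : WordBound (n := n) B s) :
    Runs B initProg s (30 * n + 10) fun s' =>
      ∀ v : Fin n, s'.arr 5 v = 0 ∧ s'.rarr 2 v = w v ∧ s'.rarr 3 v = 0 := by
  have hB1 := hB.size
  refine (Runs.seq (t₁ := 2) (t₂ := ∑ i ∈ Finset.Ico 0 n, (14 + 7) + 3)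
    ((Runs.of_wp (Q := fun s' => s'.var 2 = 0) ?_).mono le_rfl ?_)).mono ?_ (fun _ _ h => h)
  · simp
  · intro s₁ h1 h2 _
    have hin₁ : IsInput G w s₁ := hin.congr (h1.var _ (by decide)) (h1.arr _ (by decide))
      (h1.arr _ (by decide)) (h1.rarr _ (by decide))
    refine Runs.forLoop (fun i s' => ∀ v : Fin n, (v : ℕ) < i →
      s'.arr 5 v = 0 ∧ s'.rarr 2 v = w v ∧ s'.rarr 3 v = 0) (fun _ => 14) h2 hin₁.size
      (Nat.zero_le _) (by omega) (by decide) (by decide) (by decide) (by simp) ?_ ?_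
    · intro i _ hi s' ha hs hI
      have hw : s'.rarr 0 i = w ⟨i, hi⟩ := by
        rw [ha.rarr 0 (by decide)]
        exact hin₁.weights ⟨i, hi⟩
      refine (Runs.of_wp ?_).mono (by decide) (fun _ _ h => h)
      simp only [Prog.wp, Exp.Fits, Exp.eval, RExp.Fits, RExp.eval, State.setArr_var,
        State.setRArr_var, hs]
      refine ⟨by omega, by omega, by omega, by omega, by omega, ⟨by omega, by omega⟩, ?_⟩
      intro v hv
      by_cases hvi : (v : ℕ) = i
      · obtain rfl : v = ⟨i, hi⟩ := Fin.ext hvi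
        simp [hw]
      · simpa [hvi] using hI v (by omega)
    · intro s' _ hI v
      exact hI v v.2
  · simp
    omega

/-- The list `L` is the queue of a breadth-first search from `r` with `i` processed vertices. -/
structure IsQueue {V : Type*} (G : SimpleGraph V) (r : V) (i : ℕ) (L : List V) : Prop where
  nodup : L.Nodup
  head : L[0]? = some r
  sorted : ∀ j k : ℕ, j ≤ k → ∀ u v : V, L[j]? = some u → L[k]? = some v → G.dist r u ≤ G.dist r v
  closed : ∀ j < i, ∀ u : V, L[j]? = some u → ∀ v, G.Adj u v → v ∈ L
  near : ∀ u : V, L[i]? = some u → ∀ v ∈ L, G.dist r v ≤ G.dist r u + 1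

namespace IsQueue

variable {V : Type*} {G : SimpleGraph V} {r : V} {i : ℕ} {L : List V}

theorem _root_.MedianGraph.getElem?_concat_eq_some {L : List V} {y v : V} {j : ℕ} :
    (L ++ [y])[j]? = some v ↔ L[j]? = some v ∨ (j = L.length ∧ v = y) := by
  rcases lt_trichotomy j L.length with h | h | h
  · rw [List.getElem?_append_left h]
    simp [h.ne]
  · subst h
    simp [eq_comm]
  · rw [List.getElem?_eq_none (by simp; omega), List.getElem?_eq_none h.le]
    simp [h.ne']

theorem singleton (G : SimpleGraph V) (r : V) : IsQueue G r 0 [r] where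
  nodup := List.nodup_singleton r
  head := rfl
  sorted j k hjk u v hu hv := by
    obtain rfl : u = r := by simpa using List.mem_of_getElem? hu
    simp
  closed := by simp
  near := by simp

variable (hG : IsMedian G)

include hG

/-- Descend from y towards r until the queue is met. The vertex met there has a neighbor outside the
queue, so it is not yet processed. -/
theorem exists_unprocessed (h : IsQueue G r i L) {y : V} (hy : y ∉ L) :
    ∃ j u, i ≤ j ∧ L[j]? = some u ∧ G.dist r u < G.dist r y := by
  induction hk : G.dist r y using Nat.strong_induction_on generalizing y with
  | _ k ih =>
    have hyr : y ≠ r := by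
      rintro rfl
      exact hy (List.mem_of_getElem? h.head)
    obtain ⟨z, hyz, hd⟩ := hG.exists_down hyr
    by_cases hz : z ∈ L
    · obtain ⟨j, hj⟩ := List.mem_iff_getElem?.1 hz
      refine ⟨j, z, ?_, hj, by omega⟩
      by_contra hji
      exact hy (h.closed j (by omega) z hj y hyz.symm)
    · obtain ⟨j, u, h1, h2, h3⟩ := ih _ (by omega) hz rfl
      exact ⟨j, u, h1, h2, by omega⟩

/-- A new neighbor y of x is one step further from r than x: otherwise some unprocessed vertex of
the queue would be even closer than y, although x is the first unprocessed one and the queue is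
sorted. -/
theorem concat (h : IsQueue G r i L) {x y : V} (hx : L[i]? = some x) (hxy : G.Adj x y)
    (hy : y ∉ L) : IsQueue G r i (L ++ [y]) := by
  obtain ⟨j, u, h1, h2, h3⟩ := h.exists_unprocessed hG hy
  have h4 := h.sorted i j h1 x u hx h2
  have h5 := hG.dist_adj hxy r
  have hd : G.dist r y = G.dist r x + 1 := by omega
  refine ⟨List.Nodup.append h.nodup (List.nodup_singleton y) (by simpa using hy),
    getElem?_concat_eq_some.2 (Or.inl h.head), ?_, ?_, ?_⟩
  · intro j k hjk u v hu hv
    rw [getElem?_concat_eq_some] at hu hv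
    rcases hu with hu | ⟨hu, rfl⟩ <;> rcases hv with hv | ⟨hv, rfl⟩
    · exact h.sorted j k hjk u v hu hv
    · rw [hd]
      exact h.near x hx u (List.mem_of_getElem? hu)
    · have := List.getElem?_eq_none (l := L) (i := k) (by omega)
      simp [this] at hv
    · exact le_rfl
  · intro j hj u hu v huv
    rw [getElem?_concat_eq_some] at hu
    rcases hu with hu | ⟨hu, rfl⟩
    · exact List.mem_append_left _ (h.closed j hj u hu v huv)
    · have := List.getElem?_eq_none (l := L) (i := i) (by omega)
      simp [this] at hx
  · intro u hu v hv
    rw [getElem?_concat_eq_some, hx] at hu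
    rcases hu with hu | ⟨hu, rfl⟩
    · obtain rfl : x = u := by simpa using hu
      rw [List.mem_append, List.mem_singleton] at hv
      rcases hv with hv | rfl
      · exact h.near x hx v hv
      · exact hd.le
    · simp [hu] at hx

omit hG in
theorem succ (h : IsQueue G r i L) {x : V} (hx : L[i]? = some x)
    (hall : ∀ y, G.Adj x y → y ∈ L) : IsQueue G r (i + 1) L where
  nodup := h.nodup
  head := h.head
  sorted := h.sorted
  closed j hj u hu v huv := by
    rcases (Nat.lt_succ_iff.1 hj).lt_or_eq with hj | rfl
    · exact h.closed j hj u hu v huv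
    · obtain rfl : x = u := by simpa [hx] using hu
      exact hall v huv
  near u hu v hv :=
    (h.near x hx v hv).trans (Nat.add_le_add_right (h.sorted i (i + 1) (by omega) x u hx hu) 1)

theorem mem_of_length_le (h : IsQueue G r i L) (hi : L.length ≤ i) (y : V) : y ∈ L := by
  by_contra hy
  obtain ⟨j, u, h1, h2, h3⟩ := h.exists_unprocessed hG hy
  rw [List.getElem?_eq_none (by omega)] at h2
  simp at h2

end IsQueue

/-- Word array `4` contains the queue, word array `5` the positions in the queue. -/
structure HasQueue (L : List (Fin n)) (s : State) : Prop where
  length : s.var 7 = L.length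
  get : ∀ (j : ℕ) (v : Fin n), L[j]? = some v → s.arr 4 j = v ∧ s.arr 5 v = j + 1
  unseen : ∀ v, v ∉ L → s.arr 5 v = 0

/-- Appends the neighbor at the current position to the queue, if it is new. -/
def visitProg : Prog :=
  .assign 6 (.get 1 (.var 3)) ;; .ite (.lt (.get 5 (.var 6)) (.lit 1))
    (.store 4 (.var 7) (.var 6) ;; .assign 7 (.add (.var 7) (.lit 1)) ;;
      .store 5 (.var 6) (.var 7)) .skip

/-- Breadth-first search from vertex `0`. -/
def bfsProg : Prog :=
  (.store 4 (.lit 0) (.lit 0) ;; .store 5 (.lit 0) (.lit 1) ;; .assign 7 (.lit 1) ;;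
    .assign 2 (.lit 0)) ;;
  .forLoop 2 0 (.assign 5 (.get 4 (.var 2)) ;; .row 3 4 5 visitProg)

/-- The state contains the numbering `e` of the vertices and its inverse. -/
structure HasNumbering (e : Fin n ≃ Fin n) (s : State) : Prop where
  vertex : ∀ i : Fin n, s.arr 4 i = e.symm i
  number : ∀ v : Fin n, s.arr 5 v = e v + 1

theorem runs_visitProg {B : ℕ} (hB : WordBound (n := n) B s) (hG : IsMedian G) {r x y : Fin n}
    {i : ℕ} {L : List (Fin n)} (hL : IsQueue G r i L) (hx : L[i]? = some x) (hxy : G.Adj x y)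
    (hq : HasQueue L s) (hy : s.arr 1 (s.var 3) = y) (hp : s.var 3 ≤ B) :
    Runs B visitProg s 19 fun s' =>
      ∃ L', L <+: L' ∧ IsQueue G r i L' ∧ HasQueue L' s' ∧ y ∈ L' := by
  have hB1 := hB.size
  have hlen : L.length ≤ n := by simpa using hL.nodup.length_le_card
  have hy2 := y.2
  have h5 : s.arr 5 y ≤ n := by
    by_cases hyL : y ∈ L
    · obtain ⟨j, hj⟩ := List.mem_iff_getElem?.1 hyL
      have := (List.getElem?_eq_some_iff.1 hj).1
      rw [(hq.get j y hj).2]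
      omega
    · rw [hq.unseen y hyL]
      omega
  refine (Runs.of_wp ?_).mono (by decide) (fun _ _ h => h)
  simp only [visitProg, Prog.wp, Exp.Fits, Exp.eval, Test.Fits, Test.eval, hy, State.setVar_arr,
    State.setArr_var, State.setVar_var, hq.length]
  simp only [reduceIte, Nat.reduceEqDiff]
  refine ⟨⟨hp, by omega⟩, ⟨⟨by omega, by omega⟩, by omega⟩, fun hlt => ?_, fun hlt => ?_⟩
  · have hyL : y ∉ L := fun hyL => by
      obtain ⟨j, hj⟩ := List.mem_iff_getElem?.1 hyL
      have := (hq.get j y hj).2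
      omega
    refine ⟨by omega, by omega, ⟨by omega, by omega, by omega⟩, by omega, by omega, L ++ [y],
      List.prefix_append _ _, hL.concat hG hx hxy hyL, ⟨?_, ?_, ?_⟩, by simp⟩
    · simp
    · intro j v hj
      rw [getElem?_concat_eq_some] at hj
      rcases hj with hj | ⟨rfl, rfl⟩
      · have hjl := (List.getElem?_eq_some_iff.1 hj).1
        have hvy : (v : ℕ) ≠ y := fun h => hyL (Fin.ext h ▸ List.mem_of_getElem? hj)
        simpa [hjl.ne, hvy] using hq.get j v hj
      · simp
    · intro v hv
      simp only [List.mem_append, List.mem_singleton, not_or] at hv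
      have hvy : (v : ℕ) ≠ y := fun h => hv.2 (Fin.ext h)
      simpa [hvy] using hq.unseen v hv.1
  · have hyL : y ∈ L := by
      by_contra hyL
      have := hq.unseen y hyL
      omega
    exact ⟨L, List.prefix_rfl, hL, ⟨by simpa using hq.length, hq.get, hq.unseen⟩, hyL⟩

theorem runs_bfsProg {B : ℕ} (hin : IsInput G w s) (hB : WordBound (n := n) B s)
    (hG : IsMedian G) (r : Fin n) (hr : (r : ℕ) = 0) (h5 : ∀ v : Fin n, s.arr 5 v = 0) :
    Runs B bfsProg s (26 * s.arr 0 n + 21 * n + 13) fun s' =>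
      ∃ e : Fin n ≃ Fin n, IsBFSNumbering G r (fun v => e v) ∧ HasNumbering e s' := by
  have hB1 := hB.size
  have hB2 := hB.start
  -- Per position, 19 for the visit and 7 for the loop; per vertex, 3 for fetching it, 11 for the
  -- row and 7 for the loop.
  let cost : Fin n → ℕ := fun v => 26 * (s.arr 0 ((v : ℕ) + 1) - s.arr 0 v) + 21
  refine (Runs.seq (t₁ := 10) (t₂ := ∑ v, cost v + 3)
    ((Runs.of_wp (Q := fun s' => s'.var 2 = 0 ∧ HasQueue [r] s') ?_).mono le_rfl ?_)).mono ?_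
    (fun _ _ h => h)
  · simp only [Prog.wp, Exp.Fits, Exp.eval]
    refine ⟨by omega, by omega, by omega, by omega, by omega, by omega, by simp, by simp, ?_, ?_⟩
    · intro j v hj
      obtain ⟨rfl, rfl⟩ : j = 0 ∧ r = v := by
        cases j <;> simp_all
      simp [hr]
    · intro v hv
      have : (v : ℕ) ≠ 0 := fun h => hv (by simpa using Fin.ext (h.trans hr.symm))
      simpa [this] using h5 v
  · rintro s₁ h1 ⟨h2, h3⟩ -
    have hin₁ : IsInput G w s₁ := hin.congr (h1.var _ (by decide)) (h1.arr _ (by decide))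
      (h1.arr _ (by decide)) (h1.rarr _ (by decide))
    have e1 : s₁.arr 0 = s.arr 0 := h1.arr _ (by decide)
    have hn : 0 < n := hr ▸ r.2
    -- Which vertex is processed in round i is known only during the run, so the elapsed time is
    -- part of the invariant, bounded by the costs of the processed vertices.
    refine Runs.forLoop_time (fun i T s' => ∃ L, IsQueue G r i L ∧ i ≤ L.length ∧ HasQueue L s' ∧
      T ≤ ((L.take i).map cost).sum) h2 hin₁.size (Nat.zero_le _) (by omega) (by decide)
      (by decide) (by decide) ⟨[r], .singleton G r, by simp, h3, by simp⟩ ?_ ?_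
    · rintro i T - hi s₂ ha hs ⟨L, hL, hiL, hq, hT⟩
      have hin₂ : IsInput G w s₂ := hin₁.congr (ha.var _ (by decide)) (ha.arr _ (by decide))
        (ha.arr _ (by decide)) (ha.rarr _ (by decide))
      have e2 : s₂.arr 0 = s.arr 0 := (ha.arr _ (by decide)).trans e1
      -- The queue is never exhausted early: by connectedness an exhausted queue contains all n
      -- vertices.
      have hiL' : i < L.length := by
        by_contra hc
        have h4 := hL.mem_of_length_le hG (by omega)
        have h5 := List.toFinset_card_of_nodup hL.nodup
        rw [Finset.eq_univ_iff_forall.2 fun v => List.mem_toFinset.2 (h4 v)] at h5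
        simp at h5
        omega
      obtain ⟨x, hx⟩ : ∃ x, L[i]? = some x := ⟨_, List.getElem?_eq_getElem hiL'⟩
      have h4i := (hq.get i x hx).1
      refine ⟨3 + (26 * (s.arr 0 ((x : ℕ) + 1) - s.arr 0 x) + 11), Runs.seq
        ((Runs.of_wp (Q := fun s' => s'.var 5 = x ∧ HasQueue L s') ?_).mono le_rfl ?_)⟩
      · simp only [Prog.wp, Exp.Fits, Exp.eval, hs, h4i]
        exact ⟨by omega, by simp, ⟨by simpa using hq.length, hq.get, hq.unseen⟩⟩
      · rintro s₃ ha₃ ⟨h6, hq₃⟩ -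
        have hin₃ : IsInput G w s₃ := hin₂.congr (ha₃.var _ (by decide)) (ha₃.arr _ (by decide))
          (ha₃.arr _ (by decide)) (ha₃.rarr _ (by decide))
        have e3 : s₃.arr 0 = s.arr 0 := (ha₃.arr _ (by decide)).trans e2
        have hB₃ : WordBound (n := n) B s₃ := ⟨hB.size, by rw [e3]; exact hB.start⟩
        refine (Runs.row hin₃ hB₃ x (fun p s' => ∃ L', L <+: L' ∧ IsQueue G r i L' ∧
          HasQueue L' s' ∧ ∀ q, s.arr 0 x ≤ q → q < p → ∀ u : Fin n, s₃.arr 1 q = u → u ∈ L')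
          (fun _ => 19) h6 (by decide) (by decide) (by decide) (by decide) ?_ ?_
          (Q := fun s' => ∃ L', L <+: L' ∧ IsQueue G r i L' ∧ HasQueue L' s' ∧
            ∀ u, G.Adj x u → u ∈ L') ?_).mono ?_ ?_
        · refine ⟨L, List.prefix_rfl, hL, ⟨by simpa using hq₃.length, hq₃.get, hq₃.unseen⟩, ?_⟩
          intro q h7 h8
          rw [e3] at h8
          omega
        · rintro p u h7 h8 hxu hpu s₄ ha₄ hp ⟨L', hLL, hL', hq₄, hmem⟩
          have e4 : s₄.arr 0 = s.arr 0 := (ha₄.arr _ (by decide)).trans e3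
          have e5 : s₄.arr 1 = s₃.arr 1 := ha₄.arr _ (by decide)
          have h9 := hin₃.start_le_start (v := x)
          rw [e3] at h8 h9
          have hx' : L'[i]? = some x := by
            obtain ⟨t, rfl⟩ := hLL
            rwa [List.getElem?_append_left hiL']
          refine (runs_visitProg ⟨hB.size, by rw [e4]; exact hB.start⟩ hG hL' hx' hxu hq₄
            (by rw [hp, e5, hpu]) (by omega)).mono le_rfl ?_
          rintro s₅ - ⟨L'', h10, h11, h12, h13⟩
          refine ⟨L'', hLL.trans h10, h11, ⟨by simpa using h12.length, h12.get, h12.unseen⟩, ?_⟩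
          intro q hq hq' v hv
          rcases (Nat.lt_succ_iff.1 hq').lt_or_eq with hq' | rfl
          · exact h10.subset (hmem q hq hq' v hv)
          · rwa [show v = u from Fin.ext (hv.symm.trans hpu)]
        · rintro s₄ ha₄ ⟨L', hLL, hL', hq₄, hmem⟩
          refine ⟨L', hLL, hL', hq₄, fun u hu => ?_⟩
          obtain ⟨q, h7, h8, h9⟩ := hin₃.exists_position hu
          exact hmem q (by rwa [← e3]) h8 u h9
        · simp [e3]
          omega
        · rintro s₄ - ⟨L', hLL, hL', hq₄, hmem⟩
          obtain ⟨t, rfl⟩ := hLL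
          have hx' : (L ++ t)[i]? = some x := by rwa [List.getElem?_append_left hiL']
          refine ⟨L ++ t, hL'.succ hx' hmem, by simp; omega,
            ⟨by simpa using hq₄.length, hq₄.get, hq₄.unseen⟩, ?_⟩
          rw [List.take_add_one, hx', List.take_append_of_le_length hiL]
          rw [List.map_append, List.sum_append]
          simp only [Option.toList_some, List.map_singleton, List.sum_singleton, cost] at hT ⊢
          omega
    · rintro s₂ T ha ⟨L, hL, hnL, hq, hT⟩
      have hlen : L.length = n := le_antisymm (by simpa using hL.nodup.length_le_card) hnL
      have hmem := hL.mem_of_length_le hG hlen.le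
      rw [List.take_of_length_le hlen.le, ← List.sum_toFinset _ hL.nodup,
        Finset.eq_univ_iff_forall.2 fun v => List.mem_toFinset.2 (hmem v)] at hT
      refine ⟨Nat.add_le_add_right hT 3, ((finCongr hlen.symm).trans
        (hL.nodup.getEquivOfForallMemList L hmem)).symm, ?_, ?_⟩
      -- The number of a vertex is its position in the final queue, and the queue is sorted by
      -- distance from r.
      · have key : ∀ v, L[(((finCongr hlen.symm).trans
            (hL.nodup.getEquivOfForallMemList L hmem)).symm v : ℕ)]? = some v := by
          intro v
          obtain ⟨i, rfl⟩ := ((finCongr hlen.symm).trans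
            (hL.nodup.getEquivOfForallMemList L hmem)).surjective v
          rw [Equiv.symm_apply_apply]
          simp [hlen]
        refine ⟨fun u v h => Equiv.injective _ (Fin.ext h), fun u v huv => ?_, ?_⟩
        · by_contra hc
          have := hL.sorted _ _ (not_lt.1 hc) v u (key v) (key u)
          omega
        · have h1 := (hq.get _ _ (key r)).2
          have h2 := (hq.get _ _ hL.head).2
          exact Nat.succ.inj (h1.symm.trans h2)
      · have key : ∀ i : Fin n, L[(i : ℕ)]? = some (((finCongr hlen.symm).trans
            (hL.nodup.getEquivOfForallMemList L hmem)) i) := by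
          intro i
          simp [hlen]
        refine ⟨fun i => (hq.get _ _ (key i)).1, fun v => ?_⟩
        have := (hq.get _ _ (key (((finCongr hlen.symm).trans
            (hL.nodup.getEquivOfForallMemList L hmem)).symm v))).2
        rwa [Equiv.apply_symm_apply] at this
  · rw [Finset.sum_add_distrib, ← Finset.mul_sum, hin.sum_len_eq_start]
    simp
    omega

/-! ### Computation of labels and fathers -/

/-- `b` is the vertex with the smallest value `mn` of `M` on `S`, and `mx` is the largest value;
on the empty set, `b` is `x`, `mn` is `N` and `mx` is `0`. -/
structure IsScan {V : Type*} (M : V → ℕ) (N : ℕ) (x : V) (S : V → Prop) (b : V) (mn mx : ℕ) :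
    Prop where
  min : (b = x ∧ mn = N ∧ ∀ y, ¬ S y) ∨ (S b ∧ mn = M b)
  le : ∀ y, S y → mn ≤ M y ∧ M y ≤ mx
  max : mx = 0 ∨ ∃ y, S y ∧ M y = mx

namespace IsScan

variable {V : Type*} {M : V → ℕ} {N : ℕ} {x : V} {S T : V → Prop} {b y : V} {mn mx : ℕ}

theorem congr (h : IsScan M N x S b mn mx) (hST : ∀ y, S y ↔ T y) : IsScan M N x T b mn mx := by
  have : S = T := funext fun y => propext (hST y)
  exact this ▸ h

theorem insert (h : IsScan M N x S b mn mx) (hy : M y < N) :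
    IsScan M N x (fun z => S z ∨ z = y) (if M y < mn then y else b)
      (if M y < mn then M y else mn) (if mx < M y then M y else mx) := by
  refine ⟨Or.inr ?_, ?_, ?_⟩
  · split_ifs with hlt
    · exact ⟨Or.inr rfl, rfl⟩
    · rcases h.min with ⟨h1, h2, h3⟩ | ⟨h1, h2⟩
      · omega
      · exact ⟨Or.inl h1, h2⟩
  · rintro z (hz | rfl)
    · have := h.le z hz
      constructor <;> split_ifs <;> omega
    · constructor <;> split_ifs <;> omega
  · split_ifs with hlt
    · exact Or.inr ⟨y, Or.inr rfl, rfl⟩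
    · rcases h.max with h1 | ⟨z, h1, h2⟩
      · exact Or.inl h1
      · exact Or.inr ⟨z, Or.inl h1, h2⟩

end IsScan

variable {r : Fin n} {e : Fin n ≃ Fin n}

/-- Word arrays `6` and `7` contain the largest labels and the fathers. -/
structure HasLabels (G : SimpleGraph (Fin n)) (r : Fin n) (e : Fin n ≃ Fin n) (s : State) :
    Prop where
  label : ∀ v : Fin n, s.arr 6 v = maxLabel G r (fun v => e v) v
  father : ∀ v : Fin n, s.arr 7 v = father G r (fun v => e v) v

/-- Updates the minimum and maximum of the labels of the down-neighbors. -/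
def scanStepProg : Prog :=
  .assign 6 (.get 1 (.var 3)) ;;
  .ite (.lt (.get 5 (.var 6)) (.add (.var 2) (.lit 1)))
    (.ite (.lt (.get 6 (.var 6)) (.var 8)) (.assign 8 (.get 6 (.var 6)) ;; .assign 10 (.var 6))
        .skip ;;
      .ite (.lt (.var 9) (.get 6 (.var 6))) (.assign 9 (.get 6 (.var 6))) .skip)
    .skip

/-- Computes the labels and fathers of all vertices in their order. -/
def scanProg : Prog :=
  .assign 2 (.lit 0) ;;
  .forLoop 2 0 (
    (.assign 5 (.get 4 (.var 2)) ;; .assign 8 (.var 0) ;; .assign 9 (.lit 0) ;;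
      .assign 10 (.var 5)) ;;
    .row 3 4 5 scanStepProg ;;
    .ite (.lt (.var 8) (.var 9)) (.store 6 (.var 5) (.var 9)) (.store 6 (.var 5) (.var 2)) ;;
    .store 7 (.var 5) (.var 10))

section

variable (hG : IsMedian G) (he : IsBFSNumbering G r fun v => e v)

include hG he

omit he in
theorem maxLabel_lt_size (v : Fin n) : maxLabel G r (fun v => e v) v < n :=
  (hG.maxLabel_le v).trans_lt (e v).2

/-- Word array 5 holds numbers shifted by one, so the test compares e(y) + 1 with e(x) + 1 and
selects the down-neighbors. Their labels are available, since they are numbered before x. The start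
value n of the minimum exceeds every label. -/
theorem runs_scanStepProg {B : ℕ} (hB : n + 2 ≤ B) {x y b : Fin n} {S : Fin n → Prop}
    (hxy : G.Adj x y) (hnum : HasNumbering e s)
    (hlab : ∀ v, e v < e x → s.arr 6 v = maxLabel G r (fun v => e v) v)
    (hi : s.var 2 = e x) (hb : s.var 10 = b) (hy : s.arr 1 (s.var 3) = y) (hp : s.var 3 ≤ B)
    (h : IsScan (maxLabel G r fun v => e v) n x S b (s.var 8) (s.var 9)) :
    Runs B scanStepProg s 28 fun s' => ∃ b' : Fin n, s'.var 10 = b' ∧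
      IsScan (maxLabel G r fun v => e v) n x (fun z => S z ∨ (z = y ∧ Down G r x z)) b'
        (s'.var 8) (s'.var 9) := by
  have hy2 := y.2
  have h5 := hnum.number y
  have h6 := (e y).2
  have h7 := (e x).2
  have hmn : s.var 8 ≤ B := by
    rcases h.min with ⟨-, h1, -⟩ | ⟨-, h1⟩
    · omega
    · have := maxLabel_lt_size (r := r) (e := e) hG b
      omega
  have hmx : s.var 9 ≤ B := by
    rcases h.max with h1 | ⟨y, -, h1⟩
    · omega
    · have := maxLabel_lt_size (r := r) (e := e) hG y
      omega
  have hd := hG.down_iff he hxy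
  refine (Runs.of_wp ?_).mono (by decide) (fun _ _ h => h)
  simp only [scanStepProg, Prog.wp, Exp.Fits, Exp.eval, Test.Fits, Test.eval, hy,
    State.setVar_arr, State.setVar_var, hi]
  simp only [reduceIte, Nat.reduceEqDiff]
  refine ⟨⟨hp, by omega⟩, ⟨⟨by omega, by omega⟩, by omega, by omega, by omega⟩,
    fun hlt => ?_, fun hlt => ?_⟩
  · have hlt' : (e y : ℕ) < e x := by omega
    have hM := hlab y hlt'
    have hMn := maxLabel_lt_size (r := r) (e := e) hG y
    have hins := (h.insert hMn).congr
      (T := fun z => S z ∨ (z = y ∧ Down G r x z)) fun z => by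
        refine or_congr_right ⟨fun hz => ⟨hz, hz ▸ hd.2 hlt'⟩, fun hz => hz.1⟩
    rw [hM]
    refine ⟨⟨⟨by omega, by omega⟩, hmn⟩, fun h1 => ?_, fun h1 => ?_⟩
    · rw [if_pos h1, if_pos h1] at hins
      refine ⟨⟨by omega, by omega⟩, by omega, ⟨hmx, by omega, by omega⟩, fun h2 => ?_,
        fun h2 => ?_⟩
      · rw [if_pos h2] at hins
        exact ⟨⟨by omega, by omega⟩, y, rfl, hins⟩
      · rw [if_neg h2] at hins
        exact ⟨y, rfl, hins⟩
    · rw [if_neg h1, if_neg h1] at hins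
      refine ⟨⟨hmx, by omega, by omega⟩, fun h2 => ?_, fun h2 => ?_⟩
      · rw [if_pos h2] at hins
        exact ⟨⟨by omega, by omega⟩, b, hb, hins⟩
      · rw [if_neg h2] at hins
        exact ⟨b, hb, hins⟩
  · refine ⟨b, hb, h.congr fun z => ⟨Or.inl, ?_⟩⟩
    rintro (hz | ⟨rfl, hz⟩)
    · exact hz
    · have : (e z : ℕ) < e x := hd.1 hz
      omega

theorem runs_scanProg {B : ℕ} (hin : IsInput G w s) (hB : WordBound (n := n) B s)
    (hnum : HasNumbering e s) :
    Runs B scanProg s (35 * s.arr 0 n + 46 * n + 5) fun s' => HasLabels G r e s' := by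
  have hB1 := hB.size
  have hB2 := hB.start
  let cost : ℕ → ℕ := fun i => if h : i < n then
    35 * (s.arr 0 ((e.symm ⟨i, h⟩ : ℕ) + 1) - s.arr 0 (e.symm ⟨i, h⟩)) + 39 else 0
  refine (Runs.seq (t₁ := 2) (t₂ := ∑ i ∈ Finset.Ico 0 n, (cost i + 7) + 3)
    ((Runs.of_wp (Q := fun s' => s'.var 2 = 0) ?_).mono le_rfl ?_)).mono ?_ (fun _ _ h => h)
  · simp
  · intro s₁ h1 h2 _
    have hin₁ : IsInput G w s₁ := hin.congr (h1.var _ (by decide)) (h1.arr _ (by decide))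
      (h1.arr _ (by decide)) (h1.rarr _ (by decide))
    have e1 : s₁.arr 0 = s.arr 0 := h1.arr _ (by decide)
    refine Runs.forLoop (fun i s' => ∀ v, (e v : ℕ) < i →
      s'.arr 6 v = maxLabel G r (fun v => e v) v ∧ s'.arr 7 v = father G r (fun v => e v) v)
      cost h2 hin₁.size (Nat.zero_le _) (by omega) (by decide) (by decide) (by decide)
      (by simp) ?_ ?_
    · intro i _ hi s₂ ha hs hI
      have hin₂ : IsInput G w s₂ := hin₁.congr (ha.var _ (by decide)) (ha.arr _ (by decide))
        (ha.arr _ (by decide)) (ha.rarr _ (by decide))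
      have e2 : s₂.arr 0 = s.arr 0 := (ha.arr _ (by decide)).trans e1
      have hnum₂ : HasNumbering e s₂ := by
        constructor
        · rw [ha.arr 4 (by decide), h1.arr 4 (by decide)]
          exact hnum.vertex
        · rw [ha.arr 5 (by decide), h1.arr 5 (by decide)]
          exact hnum.number
      obtain ⟨x, hx⟩ : ∃ x, x = e.symm ⟨i, hi⟩ := ⟨_, rfl⟩
      have hex : (e x : ℕ) = i := by rw [hx, Equiv.apply_symm_apply]
      have h4 : s₂.arr 4 i = x := hx ▸ hnum₂.vertex ⟨i, hi⟩
      simp only [cost, hi, dif_pos, ← hx]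
      refine (Runs.seq (t₁ := 9)
        (t₂ := 35 * (s.arr 0 ((x : ℕ) + 1) - s.arr 0 x) + 11 + 18)
        ((Runs.of_wp (Q := fun s' => s'.var 5 = x ∧ s'.var 8 = n ∧ s'.var 9 = 0 ∧ s'.var 10 = x)
        ?_).mono le_rfl ?_)).mono (by omega) (fun _ _ h => h)
      · simp [hs, h4, hin₂.size]
        omega
      rintro s₃ ha₃ ⟨h5, h8, h9, h10⟩ -
      have hin₃ : IsInput G w s₃ := hin₂.congr (ha₃.var _ (by decide)) (ha₃.arr _ (by decide))
        (ha₃.arr _ (by decide)) (ha₃.rarr _ (by decide))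
      have e3 : s₃.arr 0 = s.arr 0 := (ha₃.arr _ (by decide)).trans e2
      have hI₃ : ∀ v, (e v : ℕ) < i → s₃.arr 6 v = maxLabel G r (fun v => e v) v ∧
          s₃.arr 7 v = father G r (fun v => e v) v := by
        rw [ha₃.arr 6 (by decide), ha₃.arr 7 (by decide)]
        exact hI
      have hi₃ : s₃.var 2 = i := (ha₃.var _ (by decide)).trans hs
      have hnum₃ : HasNumbering e s₃ := by
        constructor
        · rw [ha₃.arr 4 (by decide)]
          exact hnum₂.vertex
        · rw [ha₃.arr 5 (by decide)]
          exact hnum₂.number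
      have hB₃ : WordBound (n := n) B s₃ := ⟨hB.size, by rw [e3]; exact hB.start⟩
      refine Runs.seq ((Runs.row hin₃ hB₃ x (fun p s' => ∃ b : Fin n, s'.var 10 = b ∧
        IsScan (maxLabel G r fun v => e v) n x
          (fun z => Down G r x z ∧ ∃ q, s₃.arr 0 x ≤ q ∧ q < p ∧ s₃.arr 1 q = z) b
          (s'.var 8) (s'.var 9)) (fun _ => 28) h5 (by decide) (by decide) (by decide) (by decide)
          ?_ ?_ (Q := fun s' => ∃ b : Fin n, s'.var 10 = b ∧
            IsScan (maxLabel G r fun v => e v) n x (Down G r x) b (s'.var 8) (s'.var 9))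
          ?_).mono ?_ ?_)
      · refine ⟨x, by simpa using h10, Or.inl ⟨rfl, by simpa using h8, ?_⟩, ?_,
          Or.inl (by simpa using h9)⟩
        · rintro y ⟨-, q, h11, h12, -⟩
          omega
        · rintro y ⟨-, q, h11, h12, -⟩
          omega
      · rintro p y h11 h12 hxy hpy s₄ ha₄ hp ⟨b, hb, hscan⟩
        have h13 := hin₃.start_le_start (v := x)
        rw [e3] at h12 h13
        refine (runs_scanStepProg hG he hB1 hxy (s := s₄) ?_ (fun v hv => ?_)
          (by rw [ha₄.var 2 (by decide), hi₃, hex]) hb (by rw [hp, ha₄.arr 1 (by decide), hpy])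
          (by omega) hscan).mono le_rfl ?_
        · constructor
          · rw [ha₄.arr 4 (by decide)]
            exact hnum₃.vertex
          · rw [ha₄.arr 5 (by decide)]
            exact hnum₃.number
        · rw [ha₄.arr 6 (by decide)]
          exact (hI₃ v (hex ▸ hv)).1
        · rintro s₅ - ⟨b', hb', hscan'⟩
          refine ⟨b', by simpa using hb', ?_⟩
          simp only [State.setVar_var, Nat.reduceEqDiff, reduceIte]
          refine hscan'.congr fun z => ?_
          constructor
          · rintro (⟨h14, q, h15, h16, h17⟩ | ⟨rfl, h14⟩)
            · exact ⟨h14, q, h15, by omega, h17⟩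
            · exact ⟨h14, p, h11, by omega, hpy⟩
          · rintro ⟨h14, q, h15, h16, h17⟩
            rcases (Nat.lt_succ_iff.1 h16).lt_or_eq with h16 | rfl
            · exact Or.inl ⟨h14, q, h15, h16, h17⟩
            · exact Or.inr ⟨Fin.ext (h17.symm.trans hpy), h14⟩
      · rintro s₄ ha₄ ⟨b, hb, hscan⟩
        refine ⟨b, hb, hscan.congr fun z => ⟨fun h => h.1, fun h => ⟨h, ?_⟩⟩⟩
        exact hin₃.exists_position h.1
      · simp [e3]
        omega
      · rintro s₄ ha₄ ⟨b, hb, hscan⟩ -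
        obtain ⟨h14, h15⟩ := hG.scan_spec he hscan.min hscan.le hscan.max
        have hx₄ : s₄.var 5 = x := (ha₄.var _ (by decide)).trans h5
        have hi₄ : s₄.var 2 = i := (ha₄.var _ (by decide)).trans hi₃
        have hI₄ : ∀ v, (e v : ℕ) < i → s₄.arr 6 v = maxLabel G r (fun v => e v) v ∧
            s₄.arr 7 v = father G r (fun v => e v) v := by
          rw [ha₄.arr 6 (by decide), ha₄.arr 7 (by decide)]
          exact hI₃
        have hx2 := x.2
        have hb2 := b.2
        have hmn : s₄.var 8 ≤ B := by
          rcases hscan.min with ⟨-, h1, -⟩ | ⟨-, h1⟩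
          · omega
          · have := maxLabel_lt_size (r := r) (e := e) hG b
            omega
        have hmx : s₄.var 9 ≤ B := by
          rcases hscan.max with h1 | ⟨y, -, h1⟩
          · omega
          · have := maxLabel_lt_size (r := r) (e := e) hG y
            omega
        refine (Runs.of_wp ?_).mono (by decide) (fun _ _ h => h)
        rw [hex] at h15
        simp only [Prog.wp, Exp.Fits, Exp.eval, Test.Fits, Test.eval, hx₄, hi₄, hb,
          State.setArr_var]
        have key : ∀ (v : Fin n) (M b : ℕ), M = maxLabel G r (fun v => e v) x →
            b = father G r (fun v => e v) x → (e v : ℕ) < i + 1 →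
            ((((s₄.setArr 6 x M).setArr 7 x b).setVar 2 (i + 1)).arr 6 v =
              maxLabel G r (fun v => e v) v ∧
            (((s₄.setArr 6 x M).setArr 7 x b).setVar 2 (i + 1)).arr 7 v =
              father G r (fun v => e v) v) := by
          rintro v M b hM hb hv
          by_cases hvx : v = x
          · simp [hvx, hM, hb]
          · have hvx' : (v : ℕ) ≠ x := fun h => hvx (Fin.ext h)
            have hev : (e v : ℕ) ≠ i := fun h => hvx (e.injective (Fin.ext (h.trans hex.symm)))
            simpa [hvx'] using hI₄ v (by omega)
        refine ⟨⟨hmn, hmx⟩, fun hlt => ?_, fun hlt => ?_⟩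
        · rw [if_pos hlt] at h15
          exact ⟨by omega, hmx, by omega, by omega, fun v hv => key v _ _ h15.symm (by rw [h14]) hv⟩
        · rw [if_neg hlt] at h15
          exact ⟨by omega, by omega, by omega, by omega,
            fun v hv => key v _ _ h15.symm (by rw [h14]) hv⟩
    · intro s₂ ha hI
      exact ⟨fun v => (hI v (e v).2).1, fun v => (hI v (e v).2).2⟩
  · have h1 : ∑ i ∈ Finset.range n, cost i =
        ∑ v : Fin n, (35 * (s.arr 0 ((v : ℕ) + 1) - s.arr 0 v) + 39) := by
      rw [← Fin.sum_univ_eq_sum_range, ← Equiv.sum_comp e]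
      simp [cost]
    rw [← Finset.range_eq_Ico, Finset.sum_add_distrib, h1, Finset.sum_add_distrib,
      ← Finset.mul_sum, hin.sum_len_eq_start]
    simp
    omega

end

/-! ### Halfspace weights pushed along the tree -/

/-- Real variable `0` contains the total weight, real array `3` contains at each label the weight
of the halfspace. -/
structure HasLabelWeights (G : SimpleGraph (Fin n)) (w : Fin n → ℝ) (r : Fin n)
    (e : Fin n ≃ Fin n) (s : State) : Prop where
  total : s.rvar 0 = ∑ v, w v
  weight : ∀ H, AwayHalfspace G r H → s.rarr 3 (label (fun v => (e v : ℕ)) H) = weight w H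

/-- Moves the weights of the vertices to their fathers, in reverse order. -/
def pushProg : Prog :=
  .assign 2 (.lit 1) ;;
  .forLoop 2 0 (
    .assign 5 (.get 4 (.sub (.var 0) (.var 2))) ;;
    .rstore 3 (.get 6 (.var 5)) (.add (.get 3 (.get 6 (.var 5))) (.get 2 (.var 5))) ;;
    .rstore 2 (.get 7 (.var 5)) (.add (.get 2 (.get 7 (.var 5))) (.get 2 (.var 5)))) ;;
  .rassign 0 (.get 2 (.lit 0))

open Classical in
-- The effect of one push on the weight still held in a set: x drops out of the range of unprocessed
-- vertices, and its weight reappears at f, which has a smaller number and is thus still in the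
-- range.
theorem sum_push {V : Type*} [Fintype V] (P : V → Prop) (idx : V → ℕ) (hidx : idx.Injective)
    (T T' : V → ℝ) {x f : V} (hf : idx f < idx x)
    (hT : ∀ v, T' v = if v = f then T f + T x else T v) :
    (∑ v, if P v ∧ idx v < idx x then T' v else 0) =
      (∑ v, if P v ∧ idx v < idx x + 1 then T v else 0) + (if P f then T x else 0) -
        (if P x then T x else 0) := by
  have key : ∀ v, (if P v ∧ idx v < idx x then T' v else 0) =
      (if P v ∧ idx v < idx x + 1 then T v else 0) + (if v = f then if P f then T x else 0 else 0)
        - (if v = x then if P x then T x else 0 else 0) := by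
    intro v
    have hfx : f ≠ x := by rintro rfl; omega
    rw [hT]
    by_cases h1 : v = f
    · subst h1
      simp only [hf, hfx, show idx v < idx x + 1 by omega, and_true, if_true, if_false]
      split_ifs <;> ring
    by_cases h2 : v = x
    · subst h2
      simp [h1]
    · have : idx v < idx x + 1 ↔ idx v < idx x := by
        have : idx v ≠ idx x := fun h => h2 (hidx h)
        omega
      simp [h1, h2, this]
  rw [Finset.sum_congr rfl fun v _ => key v, Finset.sum_sub_distrib, Finset.sum_add_distrib]
  simp

section

variable (hG : IsMedian G) (he : IsBFSNumbering G r fun v => e v)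

include hG he

theorem label_lt_size {H : Set (Fin n)} (hH : AwayHalfspace G r H) :
    label (fun v => (e v : ℕ)) H < n := by
  obtain ⟨g, -, -, -, h, -⟩ := hG.exists_root_gate he hH
  rw [h]
  exact (e g).2

open Classical in
-- For each H avoiding the root, the counter of H plus the weight held by the unprocessed vertices
-- of H is always w(H). Round i treats the vertex numbered n - i, so fathers come after their
-- children and the root is never moved.
theorem runs_pushProg {B : ℕ} (hin : IsInput G w s) (hB : WordBound (n := n) B s)
    (hr : (r : ℕ) = 0) (hnum : HasNumbering e s) (hlab : HasLabels G r e s)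
    (hT : ∀ v : Fin n, s.rarr 2 v = w v) (hW : ∀ v : Fin n, s.rarr 3 v = 0) :
    Runs B pushProg s (30 * n + 8) fun s' => HasLabelWeights G w r e s' := by
  have hB1 := hB.size
  have hB2 := hB.start
  have hn : 0 < n := hr ▸ r.2
  let idx : Fin n → ℕ := fun v => e v
  let part : Set (Fin n) → ℕ → State → ℝ := fun H i s' =>
    ∑ v, if v ∈ H ∧ idx v < n + 1 - i then s'.rarr 2 v else 0
  let I : ℕ → State → Prop := fun i s' => part Set.univ i s' = ∑ v, w v ∧
    ∀ H, AwayHalfspace G r H → s'.rarr 3 (label idx H) + part H i s' = weight w H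
  refine (Runs.seq (t₁ := 2) (t₂ := (∑ i ∈ Finset.Ico 1 n, (23 + 7) + 3) + 3)
    ((Runs.of_wp (Q := fun s' => s'.var 2 = 1) ?_).mono le_rfl ?_)).mono ?_ (fun _ _ h => h)
  · simp
    omega
  · intro s₁ h1 h2 _
    have hin₁ : IsInput G w s₁ := hin.congr (h1.var _ (by decide)) (h1.arr _ (by decide))
      (h1.arr _ (by decide)) (h1.rarr _ (by decide))
    refine Runs.seq ((Runs.forLoop I (fun _ => 23) h2 hin₁.size
      hn (by omega) (by decide) (by decide) (by decide) ?_ ?_ (Q := I n) ?_).mono le_rfl ?_)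
    · have h4 : ∀ v, idx v < n := fun v => (e v).2
      rw [← h1.rarr 2 (by decide)] at hT
      rw [← h1.rarr 3 (by decide)] at hW
      refine ⟨by simp [part, hT, h4], fun H hH => ?_⟩
      have h3 := hW ⟨_, label_lt_size hG he hH⟩
      simp only at h3
      rw [h3]
      simp [part, hT, h4, weight, Set.indicator_apply]
    · rintro i hi hi' s₂ ha hs ⟨hI1, hI2⟩
      have hnum₂ : ∀ i : Fin n, s₂.arr 4 i = e.symm i := by
        rw [ha.arr 4 (by decide), h1.arr 4 (by decide)]
        exact hnum.vertex
      have hlab₂ : HasLabels G r e s₂ := by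
        constructor
        · rw [ha.arr 6 (by decide), h1.arr 6 (by decide)]
          exact hlab.label
        · rw [ha.arr 7 (by decide), h1.arr 7 (by decide)]
          exact hlab.father
      have hn₂ : s₂.var 0 = n := (ha.var _ (by decide)).trans hin₁.size
      have hk : n - i < n := by omega
      obtain ⟨x, hx⟩ : ∃ x, x = e.symm ⟨n - i, hk⟩ := ⟨_, rfl⟩
      have hex : idx x = n - i := by simp only [idx, hx, Equiv.apply_symm_apply]
      have hxr : x ≠ r := by
        rintro rfl
        have : idx x = 0 := he.root
        omega
      have h4 : s₂.arr 4 (n - i) = x := hx ▸ hnum₂ ⟨n - i, hk⟩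
      have h6 := hlab₂.label x
      have h7 := hlab₂.father x
      have hMx := maxLabel_lt_size (r := r) (e := e) hG x
      have hfx := (father G r (fun v => (e v : ℕ)) x).2
      have hlt := hG.father_lt he hxr
      set f := father G r (fun v => (e v : ℕ)) x with hf
      have hx2 := x.2
      have hpush : ∀ (H : Set (Fin n)) (s₃ : State), (∀ v : Fin n, s₃.rarr 2 v =
          if v = f then s₂.rarr 2 f + s₂.rarr 2 x else s₂.rarr 2 v) →
          part H (i + 1) s₃ = part H i s₂ + (if f ∈ H then s₂.rarr 2 x else 0) -
            (if x ∈ H then s₂.rarr 2 x else 0) := by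
        intro H s₃ h3
        have := sum_push (· ∈ H) idx he.injective (fun v => s₂.rarr 2 v) (fun v => s₃.rarr 2 v)
          hlt fun v => (h3 v).trans (by congr)
        simp only [part]
        rw [show n + 1 - (i + 1) = idx x by omega, show n + 1 - i = idx x + 1 by omega]
        exact this
      refine (Runs.of_wp ?_).mono (by decide) (fun _ _ h => h)
      simp only [Prog.wp, Exp.Fits, Exp.eval, RExp.Fits, RExp.eval, hs, hn₂, h4, h6, h7,
        State.setVar_var, State.setVar_arr, State.setRArr_var, State.setRArr_arr, reduceIte,
        State.setVar_rarr, State.setRArr_rarr, Nat.reduceEqDiff, false_and]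
      refine ⟨⟨⟨by omega, by omega⟩, by omega⟩, ⟨by omega, by omega⟩,
        ⟨⟨by omega, by omega⟩, by omega⟩, ⟨by omega, by omega⟩,
        ⟨⟨by omega, by omega⟩, by omega⟩, ?_, ?_⟩
      · rw [hpush _ _ fun v => by simp [Fin.ext_iff]]
        simpa using hI1
      · intro H hH
        rw [hpush _ _ fun v => by simp [Fin.ext_iff], ← hI2 H hH]
        -- If the tree edge above x leaves H, the pushed weight goes to the counter of H; otherwise
        -- it stays inside H or outside H, and the counter of H is untouched.
        by_cases hl : maxLabel G r idx x = label idx H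
        · obtain ⟨h8, h9⟩ := hG.mem_of_maxLabel_eq he hH hxr hl
          rw [if_neg h9, if_pos h8, ← hl]
          simp [idx]
        · have h8 := hG.mem_iff_of_maxLabel_ne hH hxr hl
          have hl' : label idx H ≠ maxLabel G r (fun v => (e v : ℕ)) x := fun h => hl h.symm
          by_cases h9 : x ∈ H
          · rw [if_pos h9, if_pos (h8.1 h9)]
            simp [hl']
          · rw [if_neg h9, if_neg fun h => h9 (h8.2 h)]
            simp [hl']
    · exact fun s' _ h => h
    · rintro s₂ ha ⟨hI1, hI2⟩ -
      -- At the end only the root still holds weight: the total, none of it in a halfspace avoiding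
      -- the root.
      have hpart : ∀ H, part H n s₂ = if r ∈ H then s₂.rarr 2 0 else 0 := by
        intro H
        have h8 : ∀ v, idx v < 1 ↔ v = r := by
          intro v
          have h9 : idx r = 0 := he.root
          refine ⟨fun h => he.injective (show idx v = idx r by omega), ?_⟩
          rintro rfl
          omega
        simp only [part, show n + 1 - n = 1 by omega, h8]
        rw [Finset.sum_eq_single r]
        · simp [hr]
        · intro v _ hv
          simp [hv]
        · simp
      refine (Runs.of_wp ?_).mono (by decide) (fun _ _ h => h)
      refine ⟨Nat.zero_le _, ?_, fun H hH => ?_⟩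
      · rw [hpart] at hI1
        simpa using hI1
      · have h8 := hI2 H hH
        rw [hpart, if_neg hH.1, add_zero] at h8
        exact h8
  · simp
    omega

end

/-! ### Halfspace weights at all positions -/

/-- The position `p` is in the row of `v`. -/
def InRow {n : ℕ} (s : State) (v : Fin n) (p : ℕ) : Prop :=
  s.arr 0 v ≤ p ∧ p < s.arr 0 ((v : ℕ) + 1)

/-- If `p` is the position of a neighbor of a vertex, then `c` is the weight of the halfspace of
this neighbor. -/
def IsPositionWeight (G : SimpleGraph (Fin n)) (w : Fin n → ℝ) (s : State) (p : ℕ) (c : ℝ) :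
    Prop :=
  ∀ v u : Fin n, InRow s v p → s.arr 1 p = u → c = weight w (side G v u)

theorem IsInput.isPositionWeight (hin : IsInput G w s) {v u : Fin n} {p : ℕ} {c : ℝ}
    (hp : InRow s v p) (hu : s.arr 1 p = u) (hc : c = weight w (side G v u)) :
    IsPositionWeight G w s p c := by
  intro v' u' hp' hu'
  rw [hin.eq_of_mem_rows hp'.1 hp'.2 hp.1 hp.2, show u' = u from Fin.ext (hu'.symm.trans hu)]
  exact hc

/-- Computes the weights for the positions in the row of the vertex in word variable `13`, from
the weights for the row of its father in real array `4`. -/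
def fillRowProg : Prog :=
  .row 11 12 13 (
    .assign 14 (.get 1 (.var 11)) ;;
    .ite (.eq (.get 7 (.var 14)) (.var 13)) (.rstore 1 (.var 11) (.get 3 (.get 6 (.var 14))))
      (.ite (.eq (.get 7 (.var 13)) (.var 14))
        (.rstore 1 (.var 11) (.sub (.var 0) (.get 3 (.get 6 (.var 13)))))
        (.rstore 1 (.var 11) (.get 4 (.get 7 (.var 14))))))

/-- Computes the weights for all positions. -/
def fillProg : Prog :=
  .assign 13 (.lit 0) ;; fillRowProg ;; .assign 2 (.lit 0) ;;
  .forLoop 2 0 (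
    .assign 5 (.get 4 (.var 2)) ;;
    .row 3 4 5 (.rstore 4 (.get 1 (.var 3)) (.get 1 (.var 3))) ;;
    .row 3 4 5 (.assign 13 (.get 1 (.var 3)) ;;
      .ite (.eq (.get 7 (.var 13)) (.var 5)) fillRowProg .skip))

section

variable (hG : IsMedian G) (he : IsBFSNumbering G r fun v => e v)

include hG he

/-- An edge vx is either a tree edge, whose weight is the counter of x or the total minus the
counter of v, or it is opposite to the edge between the two fathers, whose weight the temporary
array holds at the father of x. That array needs no clearing: it is only read at neighbors of the
father of v. -/
theorem runs_fillRowProg {B : ℕ} (hin : IsInput G w s) (hB : WordBound (n := n) B s)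
    (hlab : HasLabels G r e s) (hW : HasLabelWeights G w r e s) {v : Fin n}
    (hv : s.var 13 = v)
    (htmp : v = r ∨ ∀ u, G.Adj (father G r (fun v => e v) v) u →
      s.rarr 4 u = weight w (side G (father G r (fun v => e v) v) u)) :
    Runs B fillRowProg s (49 * (s.arr 0 ((v : ℕ) + 1) - s.arr 0 v) + 11) fun s' =>
      ∀ p, IsPositionWeight G w s p (s.rarr 1 p) ∨ InRow s v p →
        IsPositionWeight G w s p (s'.rarr 1 p) := by
  have hB1 := hB.size
  have hB2 := hB.start
  refine (Runs.row hin hB v (fun i s' => ∀ p, IsPositionWeight G w s p (s.rarr 1 p) ∨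
    (s.arr 0 v ≤ p ∧ p < i) → IsPositionWeight G w s p (s'.rarr 1 p)) (fun _ => 42) hv
    (by decide) (by decide) (by decide) (by decide) ?_ ?_ fun s' _ h => h).mono ?_
    fun _ _ h => h
  · rintro p (hp | hp)
    · exact hp
    · omega
  · rintro i x hi hi' hvx hix s' ha hs hI
    have h0 := hin.start_le_start (v := v)
    have h1 : s'.arr 1 i = x := by rw [ha.arr 1 (by decide), hix]
    have h13 : s'.var 13 = v := (ha.var _ (by decide)).trans hv
    have h6 : s'.arr 6 = s.arr 6 := ha.arr 6 (by decide)
    have h7 : s'.arr 7 = s.arr 7 := ha.arr 7 (by decide)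
    have h3 : s'.rarr 3 = s.rarr 3 := ha.rarr 3 (by decide)
    have h4 : s'.rarr 4 = s.rarr 4 := ha.rarr 4 (by decide)
    have hr0 : s'.rvar 0 = s.rvar 0 := ha.rvar 0 (by decide)
    have hx2 := x.2
    have hv2 := v.2
    have hMx := maxLabel_lt_size (r := r) (e := e) hG x
    have hMv := maxLabel_lt_size (r := r) (e := e) hG v
    have hfx := (father G r (fun v => (e v : ℕ)) x).2
    have hfv := (father G r (fun v => (e v : ℕ)) v).2
    have key : ∀ c : ℝ, c = weight w (side G v x) → ∀ p,
        IsPositionWeight G w s p (s.rarr 1 p) ∨ (s.arr 0 v ≤ p ∧ p < i + 1) →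
        IsPositionWeight G w s p
          ((((s'.setVar 14 x).setRArr 1 i c).setVar 11 (i + 1)).rarr 1 p) := by
      intro c hc p hp
      by_cases hpi : p = i
      · subst hpi
        simpa using hin.isPositionWeight ⟨hi, hi'⟩ hix hc
      · simpa [hpi] using hI p (hp.imp_right fun h => ⟨h.1, by omega⟩)
    refine (Runs.of_wp ?_).mono (by decide) (fun _ _ h => h)
    simp only [Prog.wp, Exp.Fits, Exp.eval, RExp.Fits, RExp.eval, hs, h1,
      State.setVar_var, State.setVar_arr, reduceIte, State.setVar_rvar,
      State.setVar_rarr, Nat.reduceEqDiff, Test.eq, Test.Fits, Test.eval, h13, h6, h7, h3, h4,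
      hlab.label, hlab.father, hr0, hW.total]
    refine ⟨⟨by omega, by omega⟩, by omega, fun hfxv => ?_, fun hfxv => ?_⟩
    · refine ⟨by omega, by omega, key _ ?_⟩
      have hfxv : father G r (fun v => (e v : ℕ)) x = v := Fin.ext (by omega)
      have hxr : x ≠ r := by
        rintro rfl
        rw [IsMedian.father_root] at hfxv
        exact hvx.ne hfxv.symm
      obtain ⟨h8, h9⟩ := hG.father_spec hxr
      rw [← h9, hW.weight _ h8.away, hfxv]
    have hfxv' : father G r (fun v => (e v : ℕ)) x ≠ v := fun h => by
      have := congrArg Fin.val h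
      omega
    refine ⟨by omega, fun hfvx => ?_, fun hfvx => ?_⟩
    · refine ⟨by omega, ⟨trivial, by omega, by omega⟩, key _ ?_⟩
      have hfvx : father G r (fun v => (e v : ℕ)) v = x := Fin.ext (by omega)
      have hvr : v ≠ r := by
        rintro rfl
        rw [IsMedian.father_root] at hfvx
        exact hvx.ne hfvx
      obtain ⟨h8, h9⟩ := hG.father_spec hvr
      rw [← h9, hW.weight _ h8.away, hfvx, ← hG.weight_side_add w hvx.symm]
      ring
    · refine ⟨by omega, by omega, key _ ?_⟩
      have hfvx' : father G r (fun v => (e v : ℕ)) v ≠ x := fun h => by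
        have := congrArg Fin.val h
        omega
      obtain ⟨h8, h9⟩ := hG.side_eq_side_father he hvx hfxv' hfvx'
      rw [h9]
      -- At the root this case does not occur, since the root is the father of all its neighbors.
      refine htmp.resolve_left (fun hvr => hfxv' ?_) _ h8
      subst hvr
      have h10 := (hG.father_spec (idx := fun v => e v) hvx.ne').1.2
      rw [SimpleGraph.dist_eq_one_iff_adj.2 hvx] at h10
      exact ((hG.1.dist_eq_zero_iff).1 (by omega)).symm
  · simp
    omega

end

theorem isPositionWeight_congr {s' : State} (h0 : s'.arr 0 = s.arr 0) (h1 : s'.arr 1 = s.arr 1) :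
    IsPositionWeight G w s' = IsPositionWeight G w s := by
  unfold IsPositionWeight InRow
  rw [h0, h1]

/-- The state contains the input `s`, the numbering, and the labels with their weights. -/
structure IsPrepared (G : SimpleGraph (Fin n)) (w : Fin n → ℝ) (r : Fin n) (e : Fin n ≃ Fin n)
    (s s' : State) : Prop where
  input : IsInput G w s'
  numbering : HasNumbering e s'
  labels : HasLabels G r e s'
  weights : HasLabelWeights G w r e s'
  start : s'.arr 0 = s.arr 0
  adj : s'.arr 1 = s.arr 1

theorem IsPrepared.of_agree {p : Prog} {s₁ s₂ : State} (h : IsPrepared G w r e s s₁)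
    (ha : Agree p s₁ s₂) (h1 : 0 ∉ p.vars) (h2 : ∀ a ∈ [0, 1, 4, 5, 6, 7], a ∉ p.arrs)
    (h3 : 0 ∉ p.rvars) (h4 : ∀ a ∈ [0, 3], a ∉ p.rarrs) : IsPrepared G w r e s s₂ := by
  have a0 := ha.arr 0 (h2 0 (by simp))
  have a1 := ha.arr 1 (h2 1 (by simp))
  refine ⟨h.input.congr (ha.var 0 h1) a0 a1 (ha.rarr 0 (h4 0 (by simp))), ⟨?_, ?_⟩, ⟨?_, ?_⟩,
    ⟨?_, ?_⟩, a0.trans h.start, a1.trans h.adj⟩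
  · rw [ha.arr 4 (h2 4 (by simp))]
    exact h.numbering.vertex
  · rw [ha.arr 5 (h2 5 (by simp))]
    exact h.numbering.number
  · rw [ha.arr 6 (h2 6 (by simp))]
    exact h.labels.label
  · rw [ha.arr 7 (h2 7 (by simp))]
    exact h.labels.father
  · rw [ha.rvar 0 h3]
    exact h.weights.total
  · rw [ha.rarr 3 (h4 3 (by simp))]
    exact h.weights.weight

/-- The entries of a row are distinct vertices, so costs charged to the neighbors of v are bounded
by a sum over all vertices. -/
theorem IsInput.sum_row_le (hin : IsInput G w s) (v : Fin n) (g : ℕ → ℕ) :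
    ∑ p ∈ Finset.Ico (s.arr 0 v) (s.arr 0 ((v : ℕ) + 1)), g (s.arr 1 p) ≤ ∑ u : Fin n, g u := by
  rw [Fin.sum_univ_eq_sum_range, ← Finset.sum_image (f := g) (g := s.arr 1)
    (by rw [Finset.coe_Ico]; exact (hin.neighbors v).injOn)]
  refine Finset.sum_le_sum_of_subset fun k hk => ?_
  obtain ⟨p, hp, rfl⟩ := Finset.mem_image.1 hk
  obtain ⟨u, -, hu⟩ := (hin.neighbors v).mapsTo (Finset.mem_Ico.1 hp)
  rw [← hu]
  exact Finset.mem_range.2 u.2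

section

variable (hG : IsMedian G) (he : IsBFSNumbering G r fun v => e v)

include hG he

/-- Fills the rows of the vertices whose father is `z`. -/
theorem runs_fillChildren {B : ℕ} {s₁ : State} (hp : IsPrepared G w r e s s₁)
    (hB : WordBound (n := n) B s) {z : Fin n} (hz : s₁.var 5 = z)
    (htmp : ∀ u, G.Adj z u → s₁.rarr 4 u = weight w (side G z u)) :
    Runs B (.row 3 4 5 (.assign 13 (.get 1 (.var 3)) ;;
        .ite (.eq (.get 7 (.var 13)) (.var 5)) fillRowProg .skip)) s₁
      (33 * (s.arr 0 ((z : ℕ) + 1) - s.arr 0 z) + 11 + ∑ u : Fin n,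
        if father G r (fun v => e v) u = z then 49 * (s.arr 0 ((u : ℕ) + 1) - s.arr 0 u) else 0)
      fun s' =>
      (∀ p, IsPositionWeight G w s p (s₁.rarr 1 p) → IsPositionWeight G w s p (s'.rarr 1 p)) ∧
      ∀ v, G.Adj z v → father G r (fun v => e v) v = z → ∀ p, InRow s v p →
        IsPositionWeight G w s p (s'.rarr 1 p) := by
  have hB1 := hB.size
  have hB2 := hB.start
  have hB₁ : WordBound (n := n) B s₁ := ⟨hB.size, by rw [hp.start]; exact hB.start⟩
  have hin₁ := hp.input
  let c : ℕ → ℕ := fun q => 26 + if s₁.arr 7 (s₁.arr 1 q) = z then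
    49 * (s.arr 0 (s₁.arr 1 q + 1) - s.arr 0 (s₁.arr 1 q)) else 0
  refine (Runs.row hin₁ hB₁ z (fun i s' =>
    (∀ p, IsPositionWeight G w s p (s₁.rarr 1 p) → IsPositionWeight G w s p (s'.rarr 1 p)) ∧
    ∀ q, s₁.arr 0 z ≤ q → q < i → ∀ v : Fin n, s₁.arr 1 q = v →
      father G r (fun v => e v) v = z → ∀ p, InRow s v p →
        IsPositionWeight G w s p (s'.rarr 1 p)) c hz (by decide) (by decide) (by decide)
    (by decide) ⟨fun p h => h, fun q h1 h2 => by omega⟩ ?_ ?_).mono ?_ fun _ _ h => h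
  · rintro i v hi hi' hzv hiv s₂ ha hs ⟨hI1, hI2⟩
    have hp₂ := hp.of_agree ha (by decide) (by decide) (by decide) (by decide)
    have h0 := hin₁.start_le_start (v := z)
    rw [hp.start] at h0 hi'
    have hv2 := v.2
    have hz2 := z.2
    have h1 : s₂.arr 1 i = v := by rw [ha.arr 1 (by decide), hiv]
    have hf1 := hp.labels.father v
    simp only [c, hiv, hf1]
    refine (Runs.seq (t₁ := 3) (t₂ := 23 + if (father G r (fun v => (e v : ℕ)) v).val = z then
      49 * (s.arr 0 ((v : ℕ) + 1) - s.arr 0 v) else 0)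
      ((Runs.of_wp (Q := fun s' => s'.var 13 = v) ?_).mono le_rfl ?_)).mono (by omega)
      fun _ _ h => h
    · simp only [Prog.wp, Exp.Fits, Exp.eval, State.setVar_var, hs, h1, reduceIte, and_true]
      omega
    intro s₃ ha₃ h13 _
    have hp₃ := hp₂.of_agree ha₃ (by decide) (by decide) (by decide) (by decide)
    have h5 : s₃.var 5 = z := by rw [ha₃.var 5 (by decide), ha.var 5 (by decide), hz]
    have h11 : s₃.rarr 1 = s₂.rarr 1 := ha₃.rarr 1 (by decide)
    have hf2 := (father G r (fun v => (e v : ℕ)) v).2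
    have hfit : (Test.eq (.get 7 (.var 13)) (.var 5)).Fits B s₃ := by
      simp only [Test.eq, Test.Fits, Test.eval, Exp.Fits, Exp.eval, h13, hp₃.labels.father, h5]
      omega
    have heval : (Test.eq (.get 7 (.var 13)) (.var 5)).eval s₃ ↔
        father G r (fun v => (e v : ℕ)) v = z := by
      simp only [Test.eq, Test.eval, Exp.eval, h13, hp₃.labels.father, h5, Fin.ext_iff]
      omega
    have step : ∀ s₄ : State,
        (∀ p, IsPositionWeight G w s p (s₂.rarr 1 p) → IsPositionWeight G w s p (s₄.rarr 1 p)) →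
        (father G r (fun v => (e v : ℕ)) v = z → ∀ p, InRow s v p →
          IsPositionWeight G w s p (s₄.rarr 1 p)) →
        (∀ p, IsPositionWeight G w s p (s₁.rarr 1 p) →
          IsPositionWeight G w s p ((s₄.setVar 3 (i + 1)).rarr 1 p)) ∧
        ∀ q, s₁.arr 0 z ≤ q → q < i + 1 → ∀ v : Fin n, s₁.arr 1 q = v →
          father G r (fun v => (e v : ℕ)) v = z → ∀ p, InRow s v p →
            IsPositionWeight G w s p ((s₄.setVar 3 (i + 1)).rarr 1 p) := by
      intro s₄ h6 h7
      refine ⟨fun p hp => h6 p (hI1 p hp), fun q hq hq' u hu hfu p hp => ?_⟩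
      rcases (Nat.lt_succ_iff.1 hq').lt_or_eq with hq' | rfl
      · exact h6 p (hI2 q hq hq' u hu hfu p hp)
      · obtain rfl : u = v := Fin.ext (hu.symm.trans hiv)
        exact h7 hfu p hp
    by_cases hfz : father G r (fun v => (e v : ℕ)) v = z
    · rw [if_pos (congrArg Fin.val hfz)]
      have h0₃ := hp₃.start
      refine Runs.ite (t₁ := 49 * (s₃.arr 0 ((v : ℕ) + 1) - s₃.arr 0 v) + 11) (t₂ := 0) hfit
        (fun _ => (runs_fillRowProg hG he hp₃.input ⟨hB.size, by rw [h0₃]; exact hB.start⟩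
          hp₃.labels hp₃.weights h13 (Or.inr ?_)).mono le_rfl ?_) (fun h => absurd (heval.2 hfz) h)
          (by rw [h0₃]; simp only [Test.eq, Test.cost, Exp.cost]; omega)
          (by simp only [Test.eq, Test.cost, Exp.cost]; omega)
      · rw [hfz, ha₃.rarr 4 (by decide), ha.rarr 4 (by decide)]
        exact htmp
      · intro s₄ _ h6
        rw [isPositionWeight_congr hp₃.start hp₃.adj, h11] at h6
        refine step s₄ (fun p h7 => h6 p (Or.inl h7)) fun _ p h7 => h6 p (Or.inr ?_)
        rwa [InRow, h0₃]
    · refine Runs.ite (t₁ := 0) (t₂ := 1) hfit (fun h => absurd (heval.1 h) hfz)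
        (fun _ => (Runs.of_wp (p := .skip) ?_).mono le_rfl fun _ _ h => h)
        (by simp only [Test.eq, Test.cost, Exp.cost]; omega)
        (by simp only [Test.eq, Test.cost, Exp.cost]; omega)
      exact step s₃ (fun p h => by rwa [h11]) fun h => absurd h hfz
  · rintro s₂ ha ⟨hI1, hI2⟩
    refine ⟨hI1, fun v hzv hfv p hpv => ?_⟩
    obtain ⟨q, h1, h2, h3⟩ := hin₁.exists_position hzv
    exact hI2 q h1 h2 v h3 hfv p hpv
  · simp only [c, Finset.sum_add_distrib]
    have h1 := hin₁.sum_row_le z fun k => if s₁.arr 7 k = z then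
      49 * (s.arr 0 (k + 1) - s.arr 0 k) else 0
    simp only [hp.labels.father, Fin.val_inj] at h1
    simp [hp.start] at h1 ⊢
    omega

/-- The row of each vertex z is copied to the temporary array, indexed by neighbors, and then serves
to fill the rows of all children of z. The row of the root is filled beforehand, without that array.
-/
theorem runs_fillProg {B : ℕ} {s₁ : State} (hp : IsPrepared G w r e s s₁)
    (hB : WordBound (n := n) B s) (hr : (r : ℕ) = 0) :
    Runs B fillProg s₁ (143 * s.arr 0 n + 32 * n + 18) fun s' =>
      ∀ (v : Fin n) p, InRow s v p → IsPositionWeight G w s p (s'.rarr 1 p) := by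
  have hB1 := hB.size
  have hB2 := hB.start
  let cost : ℕ → ℕ := fun i => if h : i < n then
    25 + (45 * (s.arr 0 ((e.symm ⟨i, h⟩ : ℕ) + 1) - s.arr 0 (e.symm ⟨i, h⟩)) +
      ∑ u : Fin n, if father G r (fun v => e v) u = e.symm ⟨i, h⟩ then
        49 * (s.arr 0 ((u : ℕ) + 1) - s.arr 0 u) else 0) else 0
  refine (Runs.seq (t₁ := 2) (t₂ := 49 * (s.arr 0 ((r : ℕ) + 1) - s.arr 0 r) + 11 +
    (2 + (∑ i ∈ Finset.Ico 0 n, (cost i + 7) + 3)))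
    ((Runs.of_wp (Q := fun s' => s'.var 13 = r) ?_).mono le_rfl ?_)).mono ?_ (fun _ _ h => h)
  · simp [hr]
  · intro s₂ ha₂ h13 _
    have hp₂ := hp.of_agree ha₂ (by decide) (by decide) (by decide) (by decide)
    rw [← hp₂.start]
    refine Runs.seq ((runs_fillRowProg hG he hp₂.input
      ⟨hB.size, by rw [hp₂.start]; exact hB.start⟩ hp₂.labels hp₂.weights h13
      (Or.inl rfl)).mono le_rfl ?_)
    intro s₃ ha₃ hrow _
    have hp₃ := hp₂.of_agree ha₃ (by decide) (by decide) (by decide) (by decide)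
    refine Runs.seq ((Runs.of_wp (Q := fun s' => s'.var 2 = 0) ?_).mono le_rfl ?_)
    · simp
    intro s₄ ha₄ h2 _
    have hp₄ := hp₃.of_agree ha₄ (by decide) (by decide) (by decide) (by decide)
    rw [isPositionWeight_congr hp₂.start hp₂.adj, ← ha₄.rarr 1 (by decide)] at hrow
    refine Runs.forLoop (fun i s' => ∀ v, (v = r ∨ (e (father G r (fun v => e v) v) : ℕ) < i) →
      ∀ p, InRow s v p → IsPositionWeight G w s p (s'.rarr 1 p)) cost h2 hp₄.input.size
      (Nat.zero_le _) (by omega) (by decide) (by decide) (by decide) ?_ ?_ ?_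
    · rintro v (rfl | h) p hv
      · exact hrow p (Or.inr (by rwa [InRow, hp₂.start]))
      · omega
    · intro i _ hi s₅ ha₅ hs hI
      have hp₅ := hp₄.of_agree ha₅ (by decide) (by decide) (by decide) (by decide)
      obtain ⟨z, hz⟩ : ∃ z, z = e.symm ⟨i, hi⟩ := ⟨_, rfl⟩
      have hez : (e z : ℕ) = i := by rw [hz, Equiv.apply_symm_apply]
      have h4 : s₅.arr 4 i = z := hz ▸ hp₅.numbering.vertex ⟨i, hi⟩
      have hz2 := z.2
      -- The father of z has a smaller number than z, so the row of z was filled in an earlier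
      -- round.
      have hzrow : ∀ p, InRow s z p → IsPositionWeight G w s p (s₅.rarr 1 p) := by
        refine hI z ?_
        by_cases hzr : z = r
        · exact Or.inl hzr
        · have : (e (father G r (fun v => e v) z) : ℕ) < e z := hG.father_lt he hzr
          exact Or.inr (by omega)
      simp only [cost, hi, dif_pos, ← hz]
      refine (Runs.seq (t₁ := 3) (t₂ := 12 * (s.arr 0 ((z : ℕ) + 1) - s.arr 0 z) + 11 +
        (33 * (s.arr 0 ((z : ℕ) + 1) - s.arr 0 z) + 11 + ∑ u : Fin n,
        if father G r (fun v => e v) u = z then 49 * (s.arr 0 ((u : ℕ) + 1) - s.arr 0 u) else 0))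
        ((Runs.of_wp (Q := fun s' => s'.var 5 = z) ?_).mono le_rfl ?_)).mono (by omega)
        (fun _ _ h => h)
      · simp [hs, h4]
        omega
      intro s₆ ha₆ h5 _
      have hp₆ := hp₅.of_agree ha₆ (by decide) (by decide) (by decide) (by decide)
      rw [← ha₆.rarr 1 (by decide)] at hzrow hI
      refine Runs.seq ((Runs.row hp₆.input ⟨hB.size, by rw [hp₆.start]; exact hB.start⟩ z
        (fun i s' => ∀ q, s₆.arr 0 z ≤ q → q < i → ∀ u : Fin n, s₆.arr 1 q = u →
          s'.rarr 4 u = weight w (side G z u)) (fun _ => 5) h5 (by decide) (by decide) (by decide)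
          (by decide) (fun q h1 h2 => by omega) ?_
          (Q := fun s' => ∀ u, G.Adj z u → s'.rarr 4 u = weight w (side G z u)) ?_).mono ?_ ?_)
      · intro q u hq hq' hzu hqu s₇ ha₇ hs₇ hI₇
        have h0 := hp₆.input.start_le_start (v := z)
        have h1 : s₇.arr 1 q = u := by rw [ha₇.arr 1 (by decide), hqu]
        have hu2 := u.2
        have hw := hzrow q (by rw [InRow, ← hp₆.start]; exact ⟨hq, hq'⟩) z u
          (by rw [InRow, ← hp₆.start]; exact ⟨hq, hq'⟩) (by rw [← hp₆.adj, hqu])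
        rw [← ha₇.rarr 1 (by decide)] at hw
        rw [hp₆.start] at h0 hq'
        refine (Runs.of_wp ?_).mono (by decide) (fun _ _ h => h)
        simp only [Prog.wp, Exp.Fits, Exp.eval, RExp.Fits, RExp.eval, hs₇, h1]
        refine ⟨by omega, by omega, fun p hp hp' v hv => ?_⟩
        by_cases hvu : v = u
        · simpa [hvu] using hw
        · have hvu' : (v : ℕ) ≠ u := fun h => hvu (Fin.ext h)
          have hpq : p ≠ q := fun h => hvu (Fin.ext (by rw [← hv, h, hqu]))
          simpa [hvu'] using hI₇ p hp (by omega) v hv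
      · intro s₇ _ hI₇ u hu
        obtain ⟨q, h6, h7, h8⟩ := hp₆.input.exists_position hu
        exact hI₇ q h6 h7 u h8
      · simp [hp₆.start]
        omega
      intro s₇ ha₇ htmp _
      have hp₇ := hp₆.of_agree ha₇ (by decide) (by decide) (by decide) (by decide)
      rw [← ha₇.rarr 1 (by decide)] at hI
      refine (runs_fillChildren hG he hp₇ hB ((ha₇.var 5 (by decide)).trans h5) htmp).mono le_rfl ?_
      rintro s₈ _ ⟨h6, h7⟩ v hv p hvp
      by_cases hold : v = r ∨ (e (father G r (fun v => e v) v) : ℕ) < i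
      · exact h6 p (hI v hold p hvp)
      · push Not at hold
        have hfz : father G r (fun v => (e v : ℕ)) v = z :=
          e.injective (Fin.ext (by have := hv.resolve_left hold.1; omega))
        exact h7 v (hfz ▸ (hG.father_spec hold.1).1.1.symm) hfz p hvp
    · intro s₅ _ hI v p hvp
      exact hI v (Or.inr (e _).2) p hvp
  · have h1 : ∑ i ∈ Finset.range n, cost i = ∑ z : Fin n,
        (25 + (45 * (s.arr 0 ((z : ℕ) + 1) - s.arr 0 z) +
          ∑ u : Fin n, if father G r (fun v => e v) u = z then
            49 * (s.arr 0 ((u : ℕ) + 1) - s.arr 0 u) else 0)) := by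
      rw [← Fin.sum_univ_eq_sum_range, ← Equiv.sum_comp e]
      simp [cost]
    have hs := hp.input.sum_len_eq_start
    rw [hp.start] at hs
    -- After exchanging the sums, each vertex is charged to its only father, so the rows of all
    -- children together cost one pass over the adjacency lists.
    rw [← Finset.range_eq_Ico, Finset.sum_add_distrib, h1, Finset.sum_add_distrib,
      Finset.sum_add_distrib, ← Finset.mul_sum, hs, Finset.sum_comm]
    simp only [Finset.sum_ite_eq, Finset.mem_univ, if_true]
    rw [← Finset.mul_sum, hs]
    have h2 := hp.input.start_le_start (v := r)
    rw [hp.start] at h2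
    simp
    omega

end

/-! ### Orientation of the edges and list of the sinks -/

/-- If `p` is the position of a neighbor of a vertex, then `c` is `1` if the edge is directed to
this neighbor, and `0` if not. -/
def IsPositionDirection (G : SimpleGraph (Fin n)) (w : Fin n → ℝ) (s : State) (p c : ℕ) : Prop :=
  ∀ v u : Fin n, InRow s v p → s.arr 1 p = u →
    (Directed G w v u → c = 1) ∧ (¬ Directed G w v u → c = 0)

/-- Orients the edges and lists the sinks. -/
def reportProg : Prog :=
  (.assign 1 (.lit 0) ;; .assign 2 (.lit 0)) ;;
  .forLoop 2 0 (
    .assign 15 (.lit 0) ;;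
    .row 3 4 2 (.ite (.rlt (.sub (.var 0) (.get 1 (.var 3))) (.get 1 (.var 3)))
      (.store 3 (.var 3) (.lit 1) ;; .assign 15 (.lit 1)) (.store 3 (.var 3) (.lit 0))) ;;
    .ite (.lt (.var 15) (.lit 1))
      (.store 2 (.var 1) (.var 2) ;; .assign 1 (.add (.var 1) (.lit 1))) .skip)

theorem bijOn_succ {f g : ℕ → ℕ} {k a : ℕ} {S : Set ℕ} (h : Set.BijOn f (Set.Iio k) S)
    (ha : a ∉ S) (hk : g k = a) (hg : ∀ j < k, g j = f j) :
    Set.BijOn g (Set.Iio (k + 1)) (insert a S) := by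
  have h1 : Set.BijOn g (Set.Iio k) S := h.congr fun j hj => (hg j hj).symm
  have h2 : Set.Iio (k + 1) = insert k (Set.Iio k) := by
    ext j
    simp only [Set.mem_Iio, Set.mem_insert_iff]
    omega
  rw [h2, ← hk]
  exact h1.insert (hk ▸ ha)

theorem runs_reportProg (hG : IsMedian G) {B : ℕ} {s₁ : State} (hp : IsPrepared G w r e s s₁)
    (hB : WordBound (n := n) B s)
    (hw : ∀ (v : Fin n) p, InRow s v p → IsPositionWeight G w s p (s₁.rarr 1 p)) :
    Runs B reportProg s₁ (22 * s.arr 0 n + 32 * n + 7) fun s' =>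
      ListsSet (sinks G w) s' ∧
        ∀ (v : Fin n) p, InRow s v p → IsPositionDirection G w s p (s'.arr 3 p) := by
  have hB1 := hB.size
  have hB2 := hB.start
  let cost : ℕ → ℕ := fun i => 22 * (s.arr 0 (i + 1) - s.arr 0 i) + 25
  refine (Runs.seq (t₁ := 4) (t₂ := ∑ i ∈ Finset.Ico 0 n, (cost i + 7) + 3)
    ((Runs.of_wp (Q := fun s' => s'.var 1 = 0 ∧ s'.var 2 = 0) ?_).mono le_rfl ?_)).mono ?_
    (fun _ _ h => h)
  · simp
  · rintro s₂ ha₂ ⟨hv1, hv2⟩ _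
    have hp₂ := hp.of_agree ha₂ (by decide) (by decide) (by decide) (by decide)
    rw [← ha₂.rarr 1 (by decide)] at hw
    refine Runs.forLoop (fun i s' =>
      Set.BijOn (s'.arr 2) (Set.Iio (s'.var 1))
        (Fin.val '' {v : Fin n | v ∈ sinks G w ∧ (v : ℕ) < i}) ∧ s'.var 1 ≤ i ∧
      ∀ q < s.arr 0 i, IsPositionDirection G w s q (s'.arr 3 q)) cost hv2 hp₂.input.size
      (Nat.zero_le _) (by omega) (by decide) (by decide) (by decide) ?_ ?_ ?_
    · refine ⟨by simp [hv1], hv1.le, fun q hq => ?_⟩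
      have := hp₂.input.start_zero
      rw [hp₂.start] at this
      omega
    · rintro i - hi s₃ ha₃ hs ⟨hI1, hI2, hI3⟩
      have hp₃ := hp₂.of_agree ha₃ (by decide) (by decide) (by decide) (by decide)
      rw [← ha₃.rarr 1 (by decide)] at hw
      obtain ⟨x, hx⟩ : ∃ x : Fin n, (x : ℕ) = i := ⟨⟨i, hi⟩, rfl⟩
      refine (Runs.seq (t₁ := 2) (t₂ := 22 * (s.arr 0 (i + 1) - s.arr 0 i) + 11 + 12)
        ((Runs.of_wp (Q := fun s' => s'.var 15 = 0) ?_).mono le_rfl ?_)).mono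
        (by simp only [cost]; omega) (fun _ _ h => h)
      · simp
      intro s₄ ha₄ h15 _
      have hp₄ := hp₃.of_agree ha₄ (by decide) (by decide) (by decide) (by decide)
      have hs₄ : s₄.var 2 = i := (ha₄.var 2 (by decide)).trans hs
      rw [← ha₄.rarr 1 (by decide)] at hw
      rw [← ha₄.arr 2 (by decide), ← ha₄.var 1 (by decide)] at hI1
      rw [← ha₄.var 1 (by decide)] at hI2
      rw [← ha₄.arr 3 (by decide)] at hI3
      refine Runs.seq ((Runs.row hp₄.input ⟨hB.size, by rw [hp₄.start]; exact hB.start⟩ x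
        (fun p s' => (∀ q < p, IsPositionDirection G w s q (s'.arr 3 q)) ∧
          ((s'.var 15 = 1 ∧ ∃ u, Directed G w x u) ∨ (s'.var 15 = 0 ∧ ∀ q, s₄.arr 0 x ≤ q →
            q < p → ∀ u : Fin n, s₄.arr 1 q = u → ¬ Directed G w x u))) (fun _ => 15)
        (hs₄.trans hx.symm) (by decide) (by decide) (by decide) (by decide) ?_ ?_
        (Q := fun s' => (∀ q < s.arr 0 (i + 1), IsPositionDirection G w s q (s'.arr 3 q)) ∧
          ((s'.var 15 = 1 ∧ x ∉ sinks G w) ∨ (s'.var 15 = 0 ∧ x ∈ sinks G w))) ?_).mono ?_ ?_)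
      · refine ⟨?_, Or.inr ⟨by simpa using h15, fun q h1 h2 => by omega⟩⟩
        rw [hp₄.start, hx]
        exact hI3
      · rintro p u h1 h2 hxu hpu s₅ ha₅ hs₅ ⟨h3, h4⟩
        have hp₅ := hp₄.of_agree ha₅ (by decide) (by decide) (by decide) (by decide)
        have h0 := hp₄.input.start_le_start (v := x)
        have hrow : InRow s x p := by
          rw [InRow, ← hp₄.start]
          exact ⟨h1, h2⟩
        have hpu' : s.arr 1 p = u := by rw [← hp₄.adj, hpu]
        have hwp : s₅.rarr 1 p = weight w (side G x u) := by
          rw [ha₅.rarr 1 (by decide)]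
          exact hw x p hrow x u hrow hpu'
        -- The opposite halfspace weighs the total minus the stored weight, so one entry decides the
        -- direction.
        have hdir : (s₅.rvar 0 - s₅.rarr 1 p < s₅.rarr 1 p) ↔ Directed G w x u := by
          rw [hG.directed_iff, hwp, hp₅.weights.total, ← hG.weight_side_add w hxu]
          simp [hxu]
        rw [hp₄.start] at h0 h2
        have key : ∀ c, ((Directed G w x u → c = 1) ∧ (¬ Directed G w x u → c = 0)) →
            IsPositionDirection G w s p c := by
          intro c hc v' u' hv' hu'
          have hin : IsInput G w s₅ := hp₅.input
          rw [InRow, ← hp₅.start] at hv' hrow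
          rw [hin.eq_of_mem_rows hv'.1 hv'.2 hrow.1 hrow.2,
            show u' = u from Fin.ext (hu'.symm.trans hpu')]
          exact hc
        have key' : ∀ c, IsPositionDirection G w s p c → ∀ q < p + 1,
            IsPositionDirection G w s q ((s₅.setArr 3 p c).arr 3 q) := by
          intro c hc q hq
          by_cases hqp : q = p
          · subst hqp
            simpa using hc
          · simpa [hqp] using h3 q (by omega)
        refine (Runs.of_wp ?_).mono (by decide) (fun _ _ h => h)
        simp only [Prog.wp, Exp.Fits, Exp.eval, RExp.Fits, RExp.eval, Test.Fits, Test.eval, hs₅]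
        refine ⟨⟨⟨trivial, by omega⟩, by omega⟩, fun hlt => ?_, fun hlt => ?_⟩
        · have hd := hdir.1 hlt
          exact ⟨by omega, by omega, by omega,
            key' 1 (key 1 ⟨fun _ => rfl, fun h => absurd hd h⟩), Or.inl ⟨by simp, u, hd⟩⟩
        · have hd := fun h => hlt (hdir.2 h)
          refine ⟨by omega, by omega, key' 0 (key 0 ⟨fun h => absurd h hd, fun _ => rfl⟩), ?_⟩
          refine h4.imp (fun h => ⟨by simpa using h.1, h.2⟩) fun h => ⟨by simpa using h.1, ?_⟩
          intro q hq hq' v hv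
          rcases (Nat.lt_succ_iff.1 hq').lt_or_eq with hq' | rfl
          · exact h.2 q hq hq' v hv
          · rwa [show v = u from Fin.ext (hv.symm.trans hpu)]
      · rintro s₅ ha₅ ⟨h3, h4⟩
        rw [hp₄.start, hx] at h3
        refine ⟨h3, h4.imp (fun h => ⟨h.1, fun hsink => ?_⟩) fun h => ⟨h.1, fun u hd => ?_⟩⟩
        · obtain ⟨u, hu⟩ := h.2
          exact hsink u hu
        · obtain ⟨q, h6, h7, h8⟩ := hp₄.input.exists_position hd.1
          exact h.2 q h6 h7 u h8 hd
      · simp [hp₄.start, hx]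
        omega
      · rintro s₅ ha₅ ⟨h3, h4⟩ -
        have hs₅ : s₅.var 2 = i := (ha₅.var 2 (by decide)).trans hs₄
        rw [← ha₅.arr 2 (by decide), ← ha₅.var 1 (by decide)] at hI1
        rw [← ha₅.var 1 (by decide)] at hI2
        refine (Runs.of_wp ?_).mono (by decide) (fun _ _ h => h)
        simp only [Prog.wp, Exp.Fits, Exp.eval, Test.Fits, Test.eval, State.setArr_var, hs₅]
        -- Word variable 15 is 1 exactly when an outgoing edge was met in the row of x, so x is
        -- listed when it is still 0.
        refine ⟨⟨by omega, by omega⟩, fun hlt => ?_, fun hlt => ?_⟩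
        · have hsink : x ∈ sinks G w := by
            rcases h4 with h4 | h4
            · omega
            · exact h4.2
          refine ⟨by omega, by omega, ⟨by omega, by omega, by omega⟩, ?_, ?_, fun q hq => ?_⟩
          · have h5 : (Fin.val '' {v : Fin n | v ∈ sinks G w ∧ (v : ℕ) < i + 1}) =
                insert i (Fin.val '' {v : Fin n | v ∈ sinks G w ∧ (v : ℕ) < i}) := by
              ext j
              simp only [Set.mem_image, Set.mem_ofPred_eq, Set.mem_insert_iff]
              constructor
              · rintro ⟨v, ⟨h6, h7⟩, rfl⟩
                by_cases hvi : (v : ℕ) = i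
                · exact Or.inl hvi
                · exact Or.inr ⟨v, ⟨h6, by omega⟩, rfl⟩
              · rintro (rfl | ⟨v, ⟨h6, h7⟩, rfl⟩)
                · exact ⟨x, ⟨hsink, by omega⟩, hx⟩
                · exact ⟨v, ⟨h6, by omega⟩, rfl⟩
            rw [h5]
            simp only [State.setVar_var, Nat.reduceEqDiff, reduceIte, State.setVar_arr]
            refine bijOn_succ hI1 ?_ (by simp) fun j hj => by simp [hj.ne]
            rintro ⟨v, ⟨-, h6⟩, h7⟩
            omega
          · simpa using hI2
          · simpa using h3 q hq
        · have hsink : x ∉ sinks G w := by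
            rcases h4 with h4 | h4
            · exact h4.2
            · omega
          refine ⟨?_, by simpa using hI2.trans (Nat.le_succ i), fun q hq => by simpa using h3 q hq⟩
          have h5 : {v : Fin n | v ∈ sinks G w ∧ (v : ℕ) < i + 1} =
              {v : Fin n | v ∈ sinks G w ∧ (v : ℕ) < i} := by
            ext v
            refine and_congr_right fun hv => ⟨fun h => ?_, fun h => by omega⟩
            have : (v : ℕ) ≠ i := fun h => hsink (Fin.ext (h.trans hx.symm) ▸ hv)
            omega
          rw [h5]
          simpa using hI1
    · rintro s₃ ha₃ ⟨hI1, hI2, hI3⟩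
      refine ⟨?_, fun v p hv => hI3 p ?_⟩
      · simpa [ListsSet] using hI1
      · have := hp₂.input.start_le_start (v := v)
        rw [hp₂.start] at this
        exact hv.2.trans_le this
  · have hs := hp.input.sum_len_eq_start
    rw [hp.start, Fin.sum_univ_eq_sum_range fun i => s.arr 0 (i + 1) - s.arr 0 i] at hs
    rw [← Finset.range_eq_Ico, Finset.sum_add_distrib, Finset.sum_add_distrib, ← Finset.mul_sum, hs]
    simp
    omega

/-! ### The whole algorithm -/

/-- The algorithm for the median set, the halfspace weights and the majority orientation. -/
def medianProg : Prog :=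
  initProg ;; bfsProg ;; scanProg ;; pushProg ;; fillProg ;; reportProg

theorem runs_medianProg (hG : IsMedian G) {B : ℕ} (hin : IsInput G w s)
    (hB : WordBound (n := n) B s) :
    Runs B medianProg s (226 * s.arr 0 n + 191 * n + 61) fun s' =>
      ListsSet (sinks G w) s' ∧ HasHalfspaceWeights G w s s' ∧ HasOrientation G w s s' := by
  obtain ⟨v₀⟩ := hG.1.nonempty
  let r : Fin n := ⟨0, (Nat.zero_le _).trans_lt v₀.2⟩
  refine Runs.mono (Runs.seq ((runs_initProg hin hB).mono le_rfl ?_)) (t₁ := 30 * n + 10 +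
    (26 * s.arr 0 n + 21 * n + 13 + (35 * s.arr 0 n + 46 * n + 5 + (30 * n + 8 +
      (143 * s.arr 0 n + 32 * n + 18 + (22 * s.arr 0 n + 32 * n + 7))))))
      (by omega) fun _ _ h => h
  intro s₁ ha₁ hinit _
  have hin₁ : IsInput G w s₁ := hin.congr (ha₁.var 0 (by decide)) (ha₁.arr 0 (by decide))
    (ha₁.arr 1 (by decide)) (ha₁.rarr 0 (by decide))
  have st₁ : s₁.arr 0 = s.arr 0 := ha₁.arr 0 (by decide)
  have hB₁ : WordBound (n := n) B s₁ := ⟨hB.size, by rw [st₁]; exact hB.start⟩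
  refine Runs.seq ((runs_bfsProg hin₁ hB₁ hG r rfl fun v => (hinit v).1).mono (by rw [st₁]) ?_)
  rintro s₂ ha₂ ⟨e, he, hnum⟩ -
  have hin₂ : IsInput G w s₂ := hin₁.congr (ha₂.var 0 (by decide)) (ha₂.arr 0 (by decide))
    (ha₂.arr 1 (by decide)) (ha₂.rarr 0 (by decide))
  have st₂ : s₂.arr 0 = s.arr 0 := (ha₂.arr 0 (by decide)).trans st₁
  have hB₂ : WordBound (n := n) B s₂ := ⟨hB.size, by rw [st₂]; exact hB.start⟩
  refine Runs.seq ((runs_scanProg hG he hin₂ hB₂ hnum).mono (by rw [st₂]) ?_)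
  rintro s₃ ha₃ hlab -
  have hin₃ : IsInput G w s₃ := hin₂.congr (ha₃.var 0 (by decide)) (ha₃.arr 0 (by decide))
    (ha₃.arr 1 (by decide)) (ha₃.rarr 0 (by decide))
  have st₃ : s₃.arr 0 = s.arr 0 := (ha₃.arr 0 (by decide)).trans st₂
  have hB₃ : WordBound (n := n) B s₃ := ⟨hB.size, by rw [st₃]; exact hB.start⟩
  have hnum₃ : HasNumbering e s₃ := by
    constructor
    · rw [ha₃.arr 4 (by decide)]
      exact hnum.vertex
    · rw [ha₃.arr 5 (by decide)]
      exact hnum.number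
  refine Runs.seq ((runs_pushProg hG he hin₃ hB₃ rfl hnum₃ hlab
    (fun v => ?_) (fun v => ?_)).mono le_rfl ?_)
  · rw [ha₃.rarr 2 (by decide), ha₂.rarr 2 (by decide)]
    exact (hinit v).2.1
  · rw [ha₃.rarr 3 (by decide), ha₂.rarr 3 (by decide)]
    exact (hinit v).2.2
  intro s₄ ha₄ hW _
  have hp : IsPrepared G w r e s s₄ := by
    refine ⟨hin₃.congr (ha₄.var 0 (by decide)) (ha₄.arr 0 (by decide)) (ha₄.arr 1 (by decide))
      (ha₄.rarr 0 (by decide)), ⟨?_, ?_⟩, ⟨?_, ?_⟩, hW, (ha₄.arr 0 (by decide)).trans st₃, ?_⟩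
    · rw [ha₄.arr 4 (by decide)]
      exact hnum₃.vertex
    · rw [ha₄.arr 5 (by decide)]
      exact hnum₃.number
    · rw [ha₄.arr 6 (by decide)]
      exact hlab.label
    · rw [ha₄.arr 7 (by decide)]
      exact hlab.father
    · rw [ha₄.arr 1 (by decide), ha₃.arr 1 (by decide), ha₂.arr 1 (by decide),
        ha₁.arr 1 (by decide)]
  refine Runs.seq ((runs_fillProg hG he hp hB rfl).mono le_rfl ?_)
  intro s₅ ha₅ hfill _
  have hp₅ := hp.of_agree ha₅ (by decide) (by decide) (by decide) (by decide)
  refine (runs_reportProg hG hp₅ hB hfill).mono le_rfl ?_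
  rintro s₆ ha₆ ⟨hlist, hdir⟩
  refine ⟨hlist, fun v u p hp hu => ?_, fun v u p hp hu => hdir v p hp v u hp hu⟩
  obtain ⟨u', hvu, hu'⟩ := hin.exists_neighbor hp.1 hp.2
  obtain rfl : u = u' := Fin.ext (hu.symm.trans hu')
  rw [ha₆.rarr 1 (by decide), hG.halfspace_eq_side hvu]
  exact hfill v p hp v u hp hu

end MedianGraph

theorem theorem5p1 :
    -- the median vertices are exactly the sinks of the majority orientation
    (∀ (V : Type*) [Fintype V] (G : SimpleGraph V) (w : V → ℝ),
      MedianGraph.IsMedian G → (∀ v, 0 ≤ w v) →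
        MedianGraph.medianSet G w = MedianGraph.sinks G w) ∧
    -- one program computes the halfspace weights, the orientation and the median set of all
    -- weighted median graphs in `O(m)` operations on reals and on words of `O(log (n + m))` bits
    (∃ (P : RealRAM.Prog) (C K : ℕ),
      ∀ (n : ℕ) (G : SimpleGraph (Fin n)) (w : Fin n → ℝ),
        MedianGraph.IsMedian G → (∀ v, 0 ≤ w v) →
        ∀ s : RealRAM.State, MedianGraph.IsInput G w s →
          ∃ (t : ℕ) (s' : RealRAM.State),
            RealRAM.Exec ((n + G.edgeSet.ncard + 1) ^ K) P s t s' ∧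
            t ≤ C * (G.edgeSet.ncard + 1) ∧
            MedianGraph.ListsSet (MedianGraph.medianSet G w) s' ∧
            MedianGraph.HasHalfspaceWeights G w s s' ∧
            MedianGraph.HasOrientation G w s s') := by
  refine ⟨fun V _ G w hG hw => hG.medianSet_eq_sinks hw, MedianGraph.medianProg, 1000, 2,
    fun n G w hG hw s hin => ?_⟩
  have hm := hin.start_eq
  have hn := hG.1.card_vert_le_card_edgeSet_add_one
  rw [Nat.card_eq_fintype_card, Fintype.card_fin, Nat.card_coe_set_eq] at hn
  have hn0 : 1 ≤ n := by
    obtain ⟨v⟩ := hG.1.nonempty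
    exact (Nat.zero_le _).trans_lt v.2
  -- The words used are bounded by n + 2 and 2m + 2, and both are at most (n + m + 1)² because n ≥
  -- 1.
  have hB : MedianGraph.WordBound (n := n) ((n + G.edgeSet.ncard + 1) ^ 2) s := by
    constructor <;> nlinarith
  obtain ⟨t, s', h1, h2, h3, h4, h5⟩ := MedianGraph.runs_medianProg hG hin hB
  rw [hG.medianSet_eq_sinks hw]
  -- With 2m positions and n ≤ m + 1 the time is at most 643m + 252.
  exact ⟨t, s', h1, by omega, h3, h4, h5⟩
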